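/- **Setting.** A bandit has $n$ arms and a mediator with $k$ values. Every pull of arm $a$ produces a tuple $(Y,O^Y,M,O^M)$ with $Y\in\mathbb R$, $M\in\{1,\dots,k\}$ and $O^Y,O^M\in\{0,1\}$, drawn independently of all other pulls from a fixed law attached to $a$. The agent observes $O^Y,O^M$, sees $Y$ only if $O^Y=1$ and $M$ only if $O^M=1$. Put $\mu_a=\mathbb E[Y\mid a]$, $p_{m,a}=\mathbb P(M=m\mid a)$, $\lambda_a=\mathbb P(O^M=1\mid a)$, $\gamma_{m,a}=\mathbb P(O^Y=1\mid M=m,a)$ and $\gamma^1_{m,a}=\mathbb P(O^Y=1\mid M=m,O^M=1,a)$. Assume, for all $a,m$: 1. $p_{m,a}>0$, $\lambda_a>0$, $\gamma^1_{m,a}>0$; 2. $\mathbb E[Y\mid m,a]\in[0,1]$, and conditionally on $M=m$ and arm $a$ the variable $Y-\mathbb E[Y\mid m,a]$ is 1-sub-Gaussian, i.e. $\mathbb E[e^{s(Y-\mathbb E[Y\mid m,a])}\mid m,a]\le e^{s^2/2}$ for all $s\in\mathbb R$; 3. $O^Y\perp Y\mid(A,M)$, $O^M\perp M\mid A$, and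 $O^M\perp Y\mid(A,M,O^Y)$. **Algorithm** (horizon $T$, parameter $\alpha>1$). First pull each arm in turn $\lceil(\log T)^2\rceil$ times. In each later round up to round $T$ pull an arm (ties broken arbitrarily) that maximizes $$\mathrm{UCB}_a=\sum_m\hat p_{m,a}\hat\mu_{m,a}+8\sqrt{\frac{\alpha\log T}{2}\sum_m\frac{\hat p_{m,a}^2}{T_{m,a,o}}},\qquad \hat p_{m,a}=\frac{s_{m,a}}{T_a},$$ where only the rounds with $O^M=1$ are used: $T_a$ is the number of previous pulls of $a$ with $O^M=1$, $s_{m,a}$ the number of those with $M=m$, $T_{m,a,o}$ the number of those with $M=m$ and $O^Y=1$, and $\hat\mu_{m,a}$ the mean of the rewards observed in the latter ($0$ if there are none). In the sum $c/0=\infty$ for $c>0$ and $0/0=0$, and $\mathrm{UCB}_a=\infty$ if $T_a=0$. For $g=(g_{m,a})$ let $P_a(g)=\sum_m\frac{p_{m,a}}{g_{m,a}\lambda_a}$ and $S(g)=\frac1n\sum_aP_a(g)$. Let $R_T=\sum_{t=1}^T(\max_a\mu_a-\mu_{a_t})$, where $a_t$ is the arm pulled in round $t$. **Theorem.** There is a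 universal constant $C>0$ such that for all $n$, $k$, $\alpha>1$ and $q>0$ there is $T_0=T_0(n,k,\alpha,q)$ such that, for every $T\ge T_0$ and every bandit as above with $p_{m,a}\gamma^1_{m,a}\lambda_a\ge q$ for all $m,a$, every run of the algorithm satisfies $$\mathbb E[R_T]\le C\sqrt{\alpha\,T\log(T)\,n\,S(\gamma^1)} .$$ If moreover $O^M\perp O^Y\mid(A,M)$, then also $\mathbb E[R_T]\le C\sqrt{\alpha\,T\log(T)\,n\,S(\gamma)}$. -/

import Mathlib

open MeasureTheory ProbabilityTheory

namespace MissingBandit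

/-- One full (partly hidden) draw of an arm: the tuple `(Y, O^Y, M, O^M)`. The outcome `Y` is real,
the mediator `M` takes `k` values, and the two indicators are Boolean (`true` means observed). -/
abbrev Draw (k : ℕ) : Type := ℝ × Bool × Fin k × Bool

/-- The outcome `Y`. -/
def outcome {k : ℕ} (z : Draw k) : ℝ := z.1

/-- The indicator `O^Y` that the outcome is observed. -/
def outcomeSeen {k : ℕ} (z : Draw k) : Bool := z.2.1

/-- The mediator `M`. -/
def mediator {k : ℕ} (z : Draw k) : Fin k := z.2.2.1

/-- The indicator `O^M` that the mediator is observed. -/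
def mediatorSeen {k : ℕ} (z : Draw k) : Bool := z.2.2.2

/-- What the agent sees of a draw: `(Y^o, M^o)`. The value `none` stands for a missing value, so the
indicators `O^Y` and `O^M` can be read off. -/
abbrev Obs (k : ℕ) : Type := Option ℝ × Option (Fin k)

/-- The observed part of a draw. -/
def observe {k : ℕ} (z : Draw k) : Obs k :=
  (if outcomeSeen z then some (outcome z) else none,
   if mediatorSeen z then some (mediator z) else none)

noncomputable section

/-! ### The environment -/

section Environment

variable {n k : ℕ} (ν : Fin n → Measure (Draw k))

/-- `μ_a = E[Y | a]`. -/
def armMean (a : Fin n) : ℝ := ∫ z, outcome z ∂(ν a)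

/-- `p_{m,a} = P(M = m | a)`. -/
def medProb (a : Fin n) (m : Fin k) : ℝ := (ν a).real {z | mediator z = m}

/-- The law of a draw of arm `a`, conditioned on `M = m`. -/
def lawGivenMed (a : Fin n) (m : Fin k) : Measure (Draw k) :=
  ProbabilityTheory.cond (ν a) {z | mediator z = m}

/-- `E[Y | m, a]`. -/
def medMean (a : Fin n) (m : Fin k) : ℝ := ∫ z, outcome z ∂(lawGivenMed ν a m)

/-- `λ_a = P(O^M = 1 | a)`. -/
def medSeenProb (a : Fin n) : ℝ := (ν a).real {z | mediatorSeen z = true}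

/-- `γ_{m,a} = P(O^Y = 1 | M = m, a)`. -/
def outSeenProb (a : Fin n) (m : Fin k) : ℝ :=
  (lawGivenMed ν a m).real {z | outcomeSeen z = true}

/-- `γ¹_{m,a} = P(O^Y = 1 | M = m, O^M = 1, a)`. -/
def outSeenProbOfMedSeen (a : Fin n) (m : Fin k) : ℝ :=
  (ProbabilityTheory.cond (ν a) {z | mediator z = m ∧ mediatorSeen z = true}).real
    {z | outcomeSeen z = true}

/-- `P_a = ∑_m p_{m,a} / (g_{m,a} λ_a)`, for a family `g` of outcome-observation probabilities. -/
def armComplexity (g : Fin n → Fin k → ℝ) (a : Fin n) : ℝ :=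
  ∑ m, medProb ν a m / (g a m * medSeenProb ν a)

/-- `S`, the arithmetic mean of the `P_a`. -/
def meanComplexity (g : Fin n → Fin k → ℝ) : ℝ :=
  (1 / (n : ℝ)) * ∑ a, armComplexity ν g a

/-- A bandit instance with missing outcome and mediator under the MAR-type assumptions. The law
`ν a` is the law of `(Y, O^Y, M, O^M)` when arm `a` is pulled. -/
structure IsMARInstance : Prop where
  isProb : ∀ a, IsProbabilityMeasure (ν a)
  /-- Positivity: `P(M = m | a) > 0`. -/
  medProb_pos : ∀ a m, 0 < medProb ν a m
  /-- Positivity: `P(O^M = 1 | a) > 0`. -/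
  medSeenProb_pos : ∀ a, 0 < medSeenProb ν a
  /-- Positivity: `P(O^Y = 1 | M = m, O^M = 1, a) > 0`; with the two previous fields this gives
  `P(O^Y = 1 | M = m, a) > 0`. -/
  outSeenProb_pos : ∀ a m, 0 < outSeenProbOfMedSeen ν a m
  /-- `E[Y | m, a] ∈ [0, 1]`. -/
  medMean_mem : ∀ a m, medMean ν a m ∈ Set.Icc (0 : ℝ) 1
  /-- Given `M = m` and arm `a`, the centred reward is 1-sub-Gaussian. -/
  subGaussian : ∀ a m,
    HasSubgaussianMGF (fun z => outcome z - medMean ν a m) 1 (lawGivenMed ν a m)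
  /-- `O^Y ⊥ Y | (A, M)`. -/
  indep_outcomeSeen_outcome : ∀ a m, IndepFun outcomeSeen outcome (lawGivenMed ν a m)
  /-- `O^M ⊥ M | A`. -/
  indep_mediatorSeen_mediator : ∀ a, IndepFun mediatorSeen mediator (ν a)
  /-- `O^M ⊥ Y | (A, M, O^Y)`; the condition holds trivially where the conditioning event has
  probability zero. -/
  indep_mediatorSeen_outcome : ∀ a m o,
    IndepFun mediatorSeen outcome
      (ProbabilityTheory.cond (ν a) {z | mediator z = m ∧ outcomeSeen z = o})

end Environment

/-! ### The algorithm -/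

section Algorithm

/-- A history: at each round (counted from `0`) the arm pulled and what was observed. Only the
rounds `s < t` are consulted below. -/
abbrev History (n k : ℕ) : Type := ℕ → Fin n × Obs k

variable {n k : ℕ} (h : History n k) (t : ℕ) (a : Fin n) (m : Fin k)

/-- `T_a`: the pulls of arm `a` before round `t` with observed mediator. A round in which the
mediator is missing updates nothing. -/
def pullsSeen : ℕ :=
  ((Finset.range t).filter fun s => (h s).1 = a ∧ (h s).2.2.isSome = true).card

/-- `s_{m,a}`: the pulls of arm `a` before round `t` in which the mediator was observed to be `m`. -/
def medCount : ℕ :=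
  ((Finset.range t).filter fun s => (h s).1 = a ∧ (h s).2.2 = some m).card

/-- The rounds before `t` in which arm `a` was pulled, the mediator was observed to be `m`, and the
outcome was observed. -/
def rewardRounds : Finset ℕ :=
  (Finset.range t).filter fun s =>
    (h s).1 = a ∧ (h s).2.2 = some m ∧ (h s).2.1.isSome = true

/-- `T_{m,a,o}`. -/
def rewardCount : ℕ := (rewardRounds h t a m).card

/-- `\hat μ_{m,a}`: the empirical mean of the observed rewards (`0` if there are none). -/
def medMeanHat : ℝ :=
  (∑ s ∈ rewardRounds h t a m, ((h s).2.1).getD 0) / (rewardCount h t a m : ℝ)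

/-- `\hat p_{m,a} = s_{m,a} / T_a`. -/
def medProbHat : ℝ := (medCount h t a m : ℝ) / (pullsSeen h t a : ℝ)

/-- `\hat μ_a = (1 / T_a) ∑_s ∑_m \hat μ_{m,a} 1{M_s = m} = ∑_m \hat p_{m,a} \hat μ_{m,a}`. -/
def armMeanHat : ℝ := ∑ m, medProbHat h t a m * medMeanHat h t a m

open Classical in
/-- The index
`UCB_a = \hat μ_a + 8 √((α log T / 2) ∑_m \hat p_{m,a}² / T_{m,a,o})`,
with the usual conventions `c / 0 = ∞` for `c > 0` and `0 / 0 = 0` in the sum, and `UCB_a = ∞` as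
long as `T_a = 0`. -/
def ucbIndex (α : ℝ) (T : ℕ) : EReal :=
  if 0 < pullsSeen h t a ∧ ∀ m, 0 < medCount h t a m → 0 < rewardCount h t a m then
    ((armMeanHat h t a + 8 * Real.sqrt (α * Real.log T / 2 *
      ∑ m, medProbHat h t a m ^ 2 / (rewardCount h t a m : ℝ)) : ℝ) : EReal)
  else ⊤

/-- The number `log(T)²` of initial pulls of each arm, rounded up. -/
def exploreRounds (T : ℕ) : ℕ := ⌈Real.log T ^ 2⌉₊

end Algorithm

/-! ### The interaction -/

section Interaction

variable {n k : ℕ} {Ω : Type*} [MeasurableSpace Ω]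

/-- The draws: `X a i` is the tuple produced by the `i`-th pull of arm `a`. They are independent,
and each `X a i` has the law `ν a`. -/
structure IsDrawTable (ν : Fin n → Measure (Draw k)) (P : Measure Ω)
    (X : Fin n → ℕ → Ω → Draw k) : Prop where
  measurable : ∀ a i, Measurable (X a i)
  law : ∀ a i, P.map (X a i) = ν a
  indep : iIndepFun (fun p : Fin n × ℕ => X p.1 p.2) P

/-- The number of pulls of arm `a` before round `t`. -/
def pulls (A : ℕ → Ω → Fin n) (a : Fin n) (t : ℕ) (ω : Ω) : ℕ :=
  ((Finset.range t).filter fun s => A s ω = a).card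

/-- The history seen by an agent that pulls the arm `A s` in round `s`. -/
def historyOf (X : Fin n → ℕ → Ω → Draw k) (A : ℕ → Ω → Fin n) (ω : Ω) : History n k :=
  fun s => (A s ω, observe (X (A s ω) (pulls A (A s ω) s ω) ω))

/-- The arms `A 0, …, A (T - 1)` are those of a run of the algorithm with parameter `α` and horizon
`T`: first each arm in turn is pulled `exploreRounds T` times, and then in every round an arm of
largest index is pulled, with ties broken in any (measurable) way. -/
structure IsRun (α : ℝ) (T : ℕ) (X : Fin n → ℕ → Ω → Draw k) (A : ℕ → Ω → Fin n) : Prop where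
  measurable : ∀ t, Measurable (A t)
  explore : ∀ ω, ∀ t < T, t < n * exploreRounds T → (A t ω : ℕ) = t / exploreRounds T
  exploit : ∀ ω, ∀ t < T, n * exploreRounds T ≤ t → ∀ b,
    ucbIndex (historyOf X A ω) t b α T ≤ ucbIndex (historyOf X A ω) t (A t ω) α T

/-- `R_T = ∑_{t < T} (max_a μ_a - μ_{A_t})`. -/
def regret (ν : Fin n → Measure (Draw k)) (A : ℕ → Ω → Fin n) (T : ℕ) (ω : Ω) : ℝ :=
  ∑ t ∈ Finset.range T, ((⨆ a, armMean ν a) - armMean ν (A t ω))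

end Interaction

end

end MissingBandit

open MissingBandit

/-!
The proof is the optimism argument for UCB, with concentration transferred to the table of draws.

Fix an arm `a` and a number `N` of its pulls. All statistics of `a` at a round in which it has been
pulled `N` times are functions of its first `N` draws alone (`ucbIndex_historyOf`), so that a union
bound over `a` and `N` replaces any martingale argument.

The error of the estimate splits as
`∑_m \hat p_m (\hat μ_m - μ_m) + (∑_m \hat p_m μ_m - μ_a)`. Each part is a weighted sum of
independent centred noise whose weights depend on the sample only through a discrete statistic:
`(O^Y, M, O^M)` for the first part and `O^M` for the second. By the missingness assumptions
the noise remains 1-sub-Gaussian given this statistic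
(`IsMARInstance.subgaussianOnFibers_rewardNoise`,
`IsMARInstance.subgaussianOnFibers_mediatorNoise`), and summing Chernoff's bound over the finitely
many patterns of the statistic gives the self-normalized tail bound
`SubgaussianOnFibers.measure_abs_sum_gt_le`. The squared norms of the two weight vectors are the
variance proxy `V = ∑_m \hat p_m² / T_{m,a,o}` of the index and `1 / T_a ≤ V`, so both errors are
covered by the exploration bonus.

The counts are sums of independent indicators with means at least `N q`. As `N ≥ log² T` after the
exploration phase, Hoeffding's inequality puts them within a factor of two of their means, up to an
event of probability smaller than any power of `1 / T`; then `V ≤ 32 P_a / N`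
(`IsTypical.varianceProxy_le`). On the event that all samples are typical, the gap of the pulled arm
is at most `64 √(α log T · P_a / N)` (`IsRun.gap_le`), and summing `1 / √N` over the pulls of each
arm and applying the Cauchy–Schwarz inequality over the arms gives `128 √(α T log T ∑_a P_a)`. The
exploration phase and the failure event cost at most `√T` for large `T`. For the second claim, the
extra independence makes `γ¹` and `γ` equal.
-/

open scoped ENNReal

namespace MissingBandit

/-! ### Sub-Gaussian noise with pattern-dependent weights -/

/-- `ε` is 1-sub-Gaussian under `ρ` on each fibre of the discrete statistic `D`. The bound on the
moment generating function is stated without normalization, so that null fibres impose nothing. -/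
def SubgaussianOnFibers {E δ : Type*} [MeasurableSpace E] (D : E → δ) (ε : E → ℝ)
    (ρ : Measure E) : Prop :=
  ∀ d s, ∫⁻ z in D ⁻¹' {d}, ENNReal.ofReal (Real.exp (s * ε z)) ∂ρ ≤
    ENNReal.ofReal (Real.exp (s ^ 2 / 2)) * ρ (D ⁻¹' {d})

theorem SubgaussianOnFibers.neg {E δ : Type*} [MeasurableSpace E] {D : E → δ} {ε : E → ℝ}
    {ρ : Measure E} (h : SubgaussianOnFibers D ε ρ) :
    SubgaussianOnFibers D (fun z => -ε z) ρ := by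
  intro d s
  simpa using h d (-s)

section Tail

variable {E δ ι Ω : Type*} [MeasurableSpace E] [MeasurableSpace δ] [MeasurableSpace Ω]
  [Fintype ι] {D : E → δ} {ε : E → ℝ} {ρ : Measure E} {P : Measure Ω} {Z : ι → Ω → E}

/-- On a fixed pattern of the statistic the weights are constants, and independence factors the
moment generating function restricted to the pattern. -/
theorem SubgaussianOnFibers.measure_pattern_le [MeasurableSingletonClass δ]
    (h : SubgaussianOnFibers D ε ρ) (hD : Measurable D) (hε : Measurable ε)
    (hZ : ∀ i, Measurable (Z i)) (hlaw : ∀ i, P.map (Z i) = ρ) (hind : iIndepFun Z P)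
    (d : ι → δ) (c : ι → ℝ) {x : ℝ} (hx : 0 ≤ x) :
    P {ω | (∀ i, D (Z i ω) = d i) ∧ x * √(∑ i, c i ^ 2) < ∑ i, c i * ε (Z i ω)} ≤
      ENNReal.ofReal (Real.exp (-(x ^ 2 / 2))) * ∏ i, ρ (D ⁻¹' {d i}) := by
  rcases (Finset.sum_nonneg fun i (_ : i ∈ Finset.univ) => sq_nonneg (c i)).eq_or_lt' with h0 | hpos
  · have hc : ∀ i, c i = 0 := fun i => by
      have := (Finset.sum_eq_zero_iff_of_nonneg fun i _ => sq_nonneg (c i)).1 h0 i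
        (Finset.mem_univ i)
      simpa using this
    simp [hc]
  set r := √(∑ i, c i ^ 2) with hr
  have hrpos : 0 < r := Real.sqrt_pos.2 hpos
  have hr2 : r ^ 2 = ∑ i, c i ^ 2 := Real.sq_sqrt hpos.le
  -- Chernoff's method with parameter `x` and the weights normalized to unit length.
  let F : E → ι → ℝ≥0∞ := fun z i =>
    (D ⁻¹' {d i}).indicator (fun z => ENNReal.ofReal (Real.exp (x * c i / r * ε z))) z
  have hF : ∀ i, Measurable fun z => F z i := fun i =>
    Measurable.indicator (by fun_prop) (hD (measurableSet_singleton _))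
  have hint : ∫⁻ ω, ∏ i, F (Z i ω) i ∂P ≤
      ENNReal.ofReal (Real.exp (x ^ 2 / 2)) * ∏ i, ρ (D ⁻¹' {d i}) := by
    have hi : iIndepFun (fun i ω => F (Z i ω) i) P :=
      hind.comp (fun i z => F z i) hF
    rw [lintegral_prod_eq_prod_lintegral_of_indepFun Finset.univ (fun i ω => F (Z i ω) i) hi
      fun i => (hF i).comp (hZ i)]
    calc ∏ i, ∫⁻ ω, F (Z i ω) i ∂P
        ≤ ∏ i, (ENNReal.ofReal (Real.exp ((x * c i / r) ^ 2 / 2)) * ρ (D ⁻¹' {d i})) := by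
          refine Finset.prod_le_prod' fun i _ => ?_
          have : ∫⁻ ω, F (Z i ω) i ∂P = ∫⁻ z, F z i ∂ρ := by
            rw [← hlaw i, lintegral_map (hF i) (hZ i)]
          rw [this, lintegral_indicator (hD (measurableSet_singleton _))]
          exact h (d i) _
      _ = _ := by
          rw [Finset.prod_mul_distrib,
            ← ENNReal.ofReal_prod_of_nonneg fun i _ => (Real.exp_pos _).le, ← Real.exp_sum]
          congr 3
          have : ∀ i, (x * c i / r) ^ 2 / 2 = x ^ 2 / 2 / r ^ 2 * c i ^ 2 := fun i => by
            field_simp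
          simp_rw [this]
          rw [← Finset.mul_sum, ← hr2]
          field_simp
  have hmarkov : ∀ ω ∈ {ω | (∀ i, D (Z i ω) = d i) ∧ x * r < ∑ i, c i * ε (Z i ω)},
      ENNReal.ofReal (Real.exp (x ^ 2)) ≤ ∏ i, F (Z i ω) i := by
    rintro ω ⟨hω, hlt⟩
    have : ∏ i, F (Z i ω) i = ENNReal.ofReal (Real.exp (∑ i, x * c i / r * ε (Z i ω))) := by
      rw [Real.exp_sum, ENNReal.ofReal_prod_of_nonneg fun i _ => (Real.exp_pos _).le]
      refine Finset.prod_congr rfl fun i _ => ?_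
      simp [F, hω i]
    rw [this]
    refine ENNReal.ofReal_le_ofReal (Real.exp_le_exp.2 ?_)
    have h1 : ∑ i, x * c i / r * ε (Z i ω) = x / r * ∑ i, c i * ε (Z i ω) := by
      rw [Finset.mul_sum]
      exact Finset.sum_congr rfl fun i _ => by ring
    rw [h1]
    calc x ^ 2 = x / r * (x * r) := by field_simp
      _ ≤ _ := by gcongr
  have hexp : ENNReal.ofReal (Real.exp (x ^ 2)) ≠ 0 := by simp [Real.exp_pos]
  calc _ ≤ P {ω | ENNReal.ofReal (Real.exp (x ^ 2)) ≤ ∏ i, F (Z i ω) i} := measure_mono hmarkov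
    _ ≤ (∫⁻ ω, ∏ i, F (Z i ω) i ∂P) / ENNReal.ofReal (Real.exp (x ^ 2)) :=
        meas_ge_le_lintegral_div
          (Finset.univ.measurable_fun_prod fun i _ => (hF i).comp (hZ i)).aemeasurable hexp
          ENNReal.ofReal_ne_top
    _ ≤ (ENNReal.ofReal (Real.exp (x ^ 2 / 2)) * ∏ i, ρ (D ⁻¹' {d i})) /
          ENNReal.ofReal (Real.exp (x ^ 2)) := by gcongr
    _ = _ := by
        rw [mul_comm, mul_div_assoc, mul_comm, ← ENNReal.ofReal_div_of_pos (Real.exp_pos _),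
          ← Real.exp_sub]
        congr 3
        ring

/-- **Self-normalized tail bound.** If the weights `c` depend on the sample only through the
pattern of the discrete statistic, then the weighted sum of the noise exceeds `x` times the norm of
the weight vector with probability at most `exp (-x² / 2)`. -/
theorem SubgaussianOnFibers.measure_sum_gt_le [Finite δ] [MeasurableSingletonClass δ]
    (h : SubgaussianOnFibers D ε ρ) (hD : Measurable D) (hε : Measurable ε)
    (hZ : ∀ i, Measurable (Z i)) (hlaw : ∀ i, P.map (Z i) = ρ) (hind : iIndepFun Z P)
    (c : Ω → ι → ℝ) (hc : ∀ ω ω', (∀ i, D (Z i ω) = D (Z i ω')) → c ω = c ω')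
    {x : ℝ} (hx : 0 ≤ x) :
    P {ω | x * √(∑ i, c ω i ^ 2) < ∑ i, c ω i * ε (Z i ω)} ≤
      ENNReal.ofReal (Real.exp (-(x ^ 2 / 2))) := by
  classical
  have := hind.isProbabilityMeasure
  have := Fintype.ofFinite δ
  have hsub : {ω | x * √(∑ i, c ω i ^ 2) < ∑ i, c ω i * ε (Z i ω)} ⊆
      ⋃ d : ι → δ, {ω | (∀ i, D (Z i ω) = d i) ∧
        x * √(∑ i, c ω i ^ 2) < ∑ i, c ω i * ε (Z i ω)} := fun ω hω =>
    Set.mem_iUnion.2 ⟨fun i => D (Z i ω), fun i => rfl, hω⟩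
  have hone : ∑ d : ι → δ, ∏ i, ρ (D ⁻¹' {d i}) = 1 := by
    have hprod : ∀ d : ι → δ, ∏ i, ρ (D ⁻¹' {d i}) = P ((fun ω i => D (Z i ω)) ⁻¹' {d}) := by
      intro d
      have h1 := hind.meas_iInter (s := fun i => Z i ⁻¹' (D ⁻¹' {d i})) fun i =>
        ⟨_, hD (measurableSet_singleton _), rfl⟩
      have h2 : (fun ω i => D (Z i ω)) ⁻¹' {d} = ⋂ i, Z i ⁻¹' (D ⁻¹' {d i}) := by
        ext ω
        simp [funext_iff]
      rw [h2, h1]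
      refine Finset.prod_congr rfl fun i _ => ?_
      rw [← hlaw i, Measure.map_apply (hZ i) (hD (measurableSet_singleton _))]
    simp_rw [hprod]
    rw [sum_measure_preimage_singleton]
    · simp
    · intro d _
      exact (measurable_pi_lambda _ fun i => hD.comp (hZ i)) (measurableSet_singleton d)
  calc _ ≤ ∑ d : ι → δ, P {ω | (∀ i, D (Z i ω) = d i) ∧
        x * √(∑ i, c ω i ^ 2) < ∑ i, c ω i * ε (Z i ω)} :=
        (measure_mono hsub).trans (measure_iUnion_fintype_le _ _)
    _ ≤ ∑ d : ι → δ, ENNReal.ofReal (Real.exp (-(x ^ 2 / 2))) * ∏ i, ρ (D ⁻¹' {d i}) := by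
        refine Finset.sum_le_sum fun d _ => ?_
        by_cases hd : ∃ ω₀, ∀ i, D (Z i ω₀) = d i
        · obtain ⟨ω₀, h₀⟩ := hd
          refine le_trans (measure_mono ?_)
            (h.measure_pattern_le hD hε hZ hlaw hind d (c ω₀) hx)
          rintro ω ⟨h1, h2⟩
          rw [hc ω ω₀ fun i => (h1 i).trans (h₀ i).symm] at h2
          exact ⟨h1, h2⟩
        · have : {ω | (∀ i, D (Z i ω) = d i) ∧
              x * √(∑ i, c ω i ^ 2) < ∑ i, c ω i * ε (Z i ω)} = ∅ :=
            Set.eq_empty_of_forall_notMem fun ω hω => hd ⟨ω, hω.1⟩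
          simp [this]
    _ = _ := by rw [← Finset.mul_sum, hone, mul_one]

theorem SubgaussianOnFibers.measure_abs_sum_gt_le [Finite δ] [MeasurableSingletonClass δ]
    (h : SubgaussianOnFibers D ε ρ) (hD : Measurable D) (hε : Measurable ε)
    (hZ : ∀ i, Measurable (Z i)) (hlaw : ∀ i, P.map (Z i) = ρ) (hind : iIndepFun Z P)
    (c : Ω → ι → ℝ) (hc : ∀ ω ω', (∀ i, D (Z i ω) = D (Z i ω')) → c ω = c ω')
    {x : ℝ} (hx : 0 ≤ x) :
    P {ω | x * √(∑ i, c ω i ^ 2) < |∑ i, c ω i * ε (Z i ω)|} ≤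
      2 * ENNReal.ofReal (Real.exp (-(x ^ 2 / 2))) := by
  have h1 := h.measure_sum_gt_le hD hε hZ hlaw hind c hc hx
  have h2 := h.neg.measure_sum_gt_le hD hε.neg hZ hlaw hind c hc hx
  rw [two_mul]
  refine le_trans (measure_mono ?_) ((measure_union_le _ _).trans (add_le_add h1 h2))
  intro ω hω
  rcases lt_abs.1 (Set.mem_ofPred.1 hω) with h' | h'
  · exact Or.inl h'
  · refine Or.inr ?_
    simpa using h'

end Tail

/-- Hoeffding's lemma for a variable with values in the unit interval, with variance proxy `1`
instead of the optimal `1 / 4`. -/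
theorem lintegral_exp_centred_le {E : Type*} [MeasurableSpace E] {ρ : Measure E}
    [IsProbabilityMeasure ρ] {f : E → ℝ} (hf : Measurable f) (h01 : ∀ z, f z ∈ Set.Icc (0 : ℝ) 1)
    (s : ℝ) : ∫⁻ z, ENNReal.ofReal (Real.exp (s * (f z - ∫ z, f z ∂ρ))) ∂ρ ≤
      ENNReal.ofReal (Real.exp (s ^ 2 / 2)) := by
  have h := hasSubgaussianMGF_of_mem_Icc (μ := ρ) hf.aemeasurable (ae_of_all _ h01)
  rw [← ofReal_integral_eq_lintegral_ofReal (h.integrable_exp_mul s)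
    (ae_of_all _ fun _ => (Real.exp_pos _).le)]
  refine ENNReal.ofReal_le_ofReal ((h.mgf_le s).trans (Real.exp_le_exp.2 ?_))
  norm_num
  nlinarith [sq_nonneg s]

/-- Hoeffding's inequality for the frequency of an event. -/
theorem measure_abs_card_sub_gt_le {E Ω : Type*} [MeasurableSpace E] [MeasurableSpace Ω]
    {ρ : Measure E} {P : Measure Ω} {N : ℕ} {Z : Fin N → Ω → E}
    (hZ : ∀ i, Measurable (Z i)) (hlaw : ∀ i, P.map (Z i) = ρ) (hind : iIndepFun Z P)
    [IsProbabilityMeasure ρ] {B : Set E} (hB : MeasurableSet B) {x : ℝ} (hx : 0 ≤ x) :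
    P {ω | x * √N < |∑ i, B.indicator 1 (Z i ω) - N * ρ.real B|} ≤
      2 * ENNReal.ofReal (Real.exp (-(x ^ 2 / 2))) := by
  have hBm : Measurable (B.indicator (1 : E → ℝ)) := measurable_one.indicator hB
  have hsub : SubgaussianOnFibers (fun _ : E => ()) (fun z => B.indicator 1 z - ρ.real B) ρ := by
    intro d s
    have := lintegral_exp_centred_le (ρ := ρ) hBm
      (fun z => ⟨Set.indicator_nonneg (by simp) z, Set.indicator_le_self' (by simp) z⟩) s
    rw [integral_indicator_one hB] at this
    simpa using this
  have := hsub.measure_abs_sum_gt_le measurable_const (hBm.sub_const _) hZ hlaw hind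
    (fun _ _ => 1) (fun _ _ _ => rfl) hx
  simpa using this

/-! ### The law of one draw under the missingness assumptions -/

section Draw

variable {k : ℕ}

@[fun_prop]
theorem measurable_outcome : Measurable (outcome : Draw k → ℝ) := measurable_fst

@[fun_prop]
theorem measurable_outcomeSeen : Measurable (outcomeSeen : Draw k → Bool) :=
  measurable_fst.comp measurable_snd

@[fun_prop]
theorem measurable_mediator : Measurable (mediator : Draw k → Fin k) :=
  measurable_fst.comp (measurable_snd.comp measurable_snd)

@[fun_prop]
theorem measurable_mediatorSeen : Measurable (mediatorSeen : Draw k → Bool) :=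
  measurable_snd.comp (measurable_snd.comp measurable_snd)

/-- The discrete part `(O^Y, M, O^M)` of a draw. -/
def status (z : Draw k) : Bool × Fin k × Bool := z.2

theorem measurable_status : Measurable (status : Draw k → Bool × Fin k × Bool) := measurable_snd

end Draw

theorem restrict_eq_smul_cond {E : Type*} [MeasurableSpace E] (μ : Measure E) [IsFiniteMeasure μ]
    (B : Set E) : μ.restrict B = μ B • ProbabilityTheory.cond μ B := by
  by_cases h : μ B = 0
  · simp [h, Measure.restrict_eq_zero.2 h]
  · rw [ProbabilityTheory.cond, smul_smul, ENNReal.mul_inv_cancel h (measure_ne_top _ _), one_smul]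

/-- Under conditional independence of `g` and `Y` given `B`, further conditioning on the value of
`g` does not change the law of `Y`. -/
theorem setLIntegral_comp_of_indepFun_cond {E β 𝓨 : Type*} [MeasurableSpace E] [MeasurableSpace β]
    [MeasurableSingletonClass β] [MeasurableSpace 𝓨]
    {μ : Measure E} [IsFiniteMeasure μ] {B : Set E} (hB : MeasurableSet B) {g : E → β} {Y : E → 𝓨}
    (hg : Measurable g) (hY : Measurable Y) (hind : IndepFun g Y (ProbabilityTheory.cond μ B))
    {f : 𝓨 → ℝ≥0∞} (hf : Measurable f) (b : β) :
    ∫⁻ z in B ∩ g ⁻¹' {b}, f (Y z) ∂μ =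
      μ (B ∩ g ⁻¹' {b}) * ∫⁻ z, f (Y z) ∂(ProbabilityTheory.cond μ B) := by
  classical
  have hb : MeasurableSet (g ⁻¹' {b}) := hg (measurableSet_singleton b)
  rw [Set.inter_comm, ← Measure.restrict_restrict hb, restrict_eq_smul_cond μ B,
    Measure.restrict_smul, lintegral_smul_measure, ← lintegral_indicator hb]
  have h1 : ∀ z, (g ⁻¹' {b}).indicator (fun z => f (Y z)) z =
      (Set.indicator {b} (1 : β → ℝ≥0∞)) (g z) * f (Y z) := fun z => by
    by_cases h : g z = b <;> simp [Set.indicator, h]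
  have hbm : Measurable (Set.indicator {b} (1 : β → ℝ≥0∞)) :=
    measurable_one.indicator (measurableSet_singleton b)
  simp_rw [h1]
  have h3 : ∫⁻ z, (Set.indicator {b} (1 : β → ℝ≥0∞)) (g z) * f (Y z)
      ∂(ProbabilityTheory.cond μ B) = (∫⁻ z, (Set.indicator {b} (1 : β → ℝ≥0∞)) (g z)
        ∂(ProbabilityTheory.cond μ B)) * ∫⁻ z, f (Y z) ∂(ProbabilityTheory.cond μ B) :=
    lintegral_mul_eq_lintegral_mul_lintegral_of_indepFun'' (hbm.comp hg).aemeasurable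
      (hf.comp hY).aemeasurable (hind.comp hbm hf)
  have h2 : ∫⁻ z, (Set.indicator {b} (1 : β → ℝ≥0∞)) (g z) ∂(ProbabilityTheory.cond μ B) =
      ProbabilityTheory.cond μ B (g ⁻¹' {b}) := by
    rw [← lintegral_indicator_one hb]
    rfl
  rw [h3, h2, smul_eq_mul, ← mul_assoc, mul_comm (μ B), cond_mul_eq_inter hB, Set.inter_comm]

section Arm

variable {n k : ℕ} {ν : Fin n → Measure (Draw k)}

/-- The centred reward of a draw in which both the mediator and the outcome are observed, and `0`
for any other draw. -/
noncomputable def rewardNoise (ν : Fin n → Measure (Draw k)) (a : Fin n) (z : Draw k) : ℝ :=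
  if outcomeSeen z = true ∧ mediatorSeen z = true then outcome z - medMean ν a (mediator z) else 0

/-- The fluctuation of the conditional mean reward due to the mediator, for a draw in which the
mediator is observed, and `0` for any other draw. -/
noncomputable def mediatorNoise (ν : Fin n → Measure (Draw k)) (a : Fin n) (z : Draw k) : ℝ :=
  if mediatorSeen z = true then medMean ν a (mediator z) - armMean ν a else 0

theorem measurable_medMean_mediator (a : Fin n) :
    Measurable fun z : Draw k => medMean ν a (mediator z) :=
  (measurable_of_countable (medMean ν a)).comp measurable_mediator

theorem measurableSet_outcomeSeen : MeasurableSet {z : Draw k | outcomeSeen z = true} :=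
  measurable_outcomeSeen (measurableSet_singleton true)

theorem measurableSet_mediatorSeen : MeasurableSet {z : Draw k | mediatorSeen z = true} :=
  measurable_mediatorSeen (measurableSet_singleton true)

theorem measurableSet_mediator (m : Fin k) : MeasurableSet {z : Draw k | mediator z = m} :=
  measurable_mediator (measurableSet_singleton m)

theorem measurable_rewardNoise (a : Fin n) : Measurable (rewardNoise ν a) :=
  Measurable.ite (measurableSet_outcomeSeen.inter measurableSet_mediatorSeen)
    (measurable_outcome.sub (measurable_medMean_mediator a)) measurable_const

theorem measurable_mediatorNoise (a : Fin n) : Measurable (mediatorNoise ν a) :=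
  Measurable.ite measurableSet_mediatorSeen
    ((measurable_medMean_mediator a).sub measurable_const) measurable_const

namespace IsMARInstance

variable (hν : IsMARInstance ν)
include hν

theorem lintegral_exp_outcome_le (a : Fin n) (m : Fin k) (s : ℝ) :
    ∫⁻ z, ENNReal.ofReal (Real.exp (s * (outcome z - medMean ν a m))) ∂(lawGivenMed ν a m) ≤
      ENNReal.ofReal (Real.exp (s ^ 2 / 2)) := by
  have h := hν.subGaussian a m
  rw [← ofReal_integral_eq_lintegral_ofReal (h.integrable_exp_mul s)
    (ae_of_all _ fun _ => (Real.exp_pos _).le)]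
  refine ENNReal.ofReal_le_ofReal ((h.mgf_le s).trans (Real.exp_le_exp.2 ?_))
  norm_num

/-- Selecting the draws with observed mediator and observed outcome does not bias the reward given
the mediator: `O^Y` is removed by its independence of `Y` given `M`, and then `O^M` by its
independence of `Y` given `M` and `O^Y`. -/
theorem setLIntegral_outcome_of_seen (a : Fin n) (m : Fin k) {f : ℝ → ℝ≥0∞} (hf : Measurable f) :
    ∫⁻ z in status ⁻¹' {(true, m, true)}, f (outcome z) ∂(ν a) =
      ν a (status ⁻¹' {(true, m, true)}) * ∫⁻ z, f (outcome z) ∂(lawGivenMed ν a m) := by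
  have := hν.isProb a
  have h1 := setLIntegral_comp_of_indepFun_cond (measurableSet_mediator m) measurable_outcomeSeen
    measurable_outcome (hν.indep_outcomeSeen_outcome a m) hf true
  have h2 := setLIntegral_comp_of_indepFun_cond
    ((measurableSet_mediator m).inter measurableSet_outcomeSeen)
    measurable_mediatorSeen measurable_outcome (hν.indep_mediatorSeen_outcome a m true) hf true
  have hset : (status ⁻¹' {(true, m, true)} : Set (Draw k)) =
      ({z | mediator z = m} ∩ {z | outcomeSeen z = true}) ∩ mediatorSeen ⁻¹' {true} := by
    ext z
    simp [status, mediator, outcomeSeen, mediatorSeen, Prod.ext_iff]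
    tauto
  have hcoe : (outcomeSeen ⁻¹' {true} : Set (Draw k)) = {z | outcomeSeen z = true} := rfl
  rw [hcoe] at h1
  rw [hset, h2]
  by_cases h0 : ν a ({z | mediator z = m} ∩ {z | outcomeSeen z = true}) = 0
  · rw [measure_mono_null Set.inter_subset_left h0]
    simp
  · congr 1
    rw [ProbabilityTheory.cond, lintegral_smul_measure, h1, smul_eq_mul, ← mul_assoc,
      ENNReal.inv_mul_cancel h0 (measure_ne_top _ _), one_mul]
    rfl

theorem subgaussianOnFibers_rewardNoise (a : Fin n) :
    SubgaussianOnFibers status (rewardNoise ν a) (ν a) := by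
  rintro ⟨oy, m, om⟩ s
  have hmeas : MeasurableSet (status ⁻¹' {(oy, m, om)} : Set (Draw k)) :=
    measurable_status (measurableSet_singleton _)
  by_cases h : oy = true ∧ om = true
  · obtain ⟨rfl, rfl⟩ := h
    have hf : Measurable fun y : ℝ => ENNReal.ofReal (Real.exp (s * (y - medMean ν a m))) := by
      fun_prop
    have h1 := hν.setLIntegral_outcome_of_seen a m hf
    rw [setLIntegral_congr_fun hmeas
      (g := fun z => ENNReal.ofReal (Real.exp (s * (outcome z - medMean ν a m)))), h1, mul_comm]
    · gcongr
      exact hν.lintegral_exp_outcome_le a m s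
    · intro z hz
      have hz' : z.2 = (true, m, true) := hz
      simp [rewardNoise, outcomeSeen, mediatorSeen, mediator, hz']
  · rw [setLIntegral_congr_fun hmeas (g := fun _ => 1)]
    · simp only [lintegral_const, one_mul, Measure.restrict_apply_univ]
      refine le_mul_of_one_le_left (zero_le) ?_
      rw [ENNReal.one_le_ofReal]
      exact Real.one_le_exp (by positivity)
    · intro z hz
      have hz' : z.2 = (oy, m, om) := hz
      simp [rewardNoise, outcomeSeen, mediatorSeen, hz', h]

theorem integrable_outcome_lawGivenMed (a : Fin n) (m : Fin k) :
    Integrable outcome (lawGivenMed ν a m) := by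
  have := hν.isProb a
  have : IsFiniteMeasure (lawGivenMed ν a m) := by unfold lawGivenMed; infer_instance
  have h := (hν.subGaussian a m).integrable
  have h2 := h.add (integrable_const (μ := lawGivenMed ν a m) (medMean ν a m))
  simpa [Pi.add_def] using h2

/-- The law of total expectation. -/
theorem armMean_eq_sum (a : Fin n) : armMean ν a = ∑ m, medProb ν a m * medMean ν a m := by
  have := hν.isProb a
  have h := sum_meas_smul_cond_fiber (measurable_mediator (k := k)) (ν a)
  rw [armMean]
  conv_lhs => rw [← h]
  rw [integral_finsetSum_measure]
  · refine Finset.sum_congr rfl fun m _ => ?_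
    rw [integral_smul_measure]
    rfl
  · intro m _
    exact (hν.integrable_outcome_lawGivenMed a m).smul_measure (measure_ne_top _ _)

theorem armMean_eq_integral (a : Fin n) :
    armMean ν a = ∫ z, medMean ν a (mediator z) ∂(ν a) := by
  have := hν.isProb a
  rw [hν.armMean_eq_sum a, ← integral_map (φ := mediator) measurable_mediator.aemeasurable
    (f := medMean ν a) (measurable_of_countable _).aestronglyMeasurable, integral_fintype]
  · refine Finset.sum_congr rfl fun m _ => ?_
    rw [map_measureReal_apply measurable_mediator (measurableSet_singleton m)]
    rfl
  · exact Integrable.of_finite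

theorem sum_medProb (a : Fin n) : ∑ m, medProb ν a m = 1 := by
  have := hν.isProb a
  have := sum_measureReal_preimage_singleton (μ := ν a) (f := (mediator : Draw k → Fin k))
    Finset.univ (fun m _ => measurableSet_mediator m)
  rw [Finset.coe_univ, Set.preimage_univ, probReal_univ] at this
  exact this

theorem armMean_mem (a : Fin n) : armMean ν a ∈ Set.Icc (0 : ℝ) 1 := by
  rw [hν.armMean_eq_sum a]
  have h0 := fun m => (hν.medProb_pos a m).le
  have h1 := hν.medMean_mem a
  refine ⟨Finset.sum_nonneg fun m _ => mul_nonneg (h0 m) (h1 m).1, ?_⟩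
  calc ∑ m, medProb ν a m * medMean ν a m ≤ ∑ m, medProb ν a m :=
        Finset.sum_le_sum fun m _ => mul_le_of_le_one_right (h0 m) (h1 m).2
    _ = 1 := hν.sum_medProb a

theorem subgaussianOnFibers_mediatorNoise (a : Fin n) :
    SubgaussianOnFibers mediatorSeen (mediatorNoise ν a) (ν a) := by
  have := hν.isProb a
  rintro om s
  have hmeas : MeasurableSet (mediatorSeen ⁻¹' {om} : Set (Draw k)) :=
    measurable_mediatorSeen (measurableSet_singleton _)
  by_cases h : om = true
  · subst h
    have hf : Measurable fun m : Fin k =>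
        ENNReal.ofReal (Real.exp (s * (medMean ν a m - armMean ν a))) := measurable_of_countable _
    have hind : IndepFun mediatorSeen mediator (ProbabilityTheory.cond (ν a) Set.univ) := by
      rw [cond_univ]
      exact hν.indep_mediatorSeen_mediator a
    have h1 := setLIntegral_comp_of_indepFun_cond MeasurableSet.univ measurable_mediatorSeen
      measurable_mediator hind hf true
    rw [cond_univ, Set.univ_inter] at h1
    rw [setLIntegral_congr_fun hmeas (g := fun z =>
      ENNReal.ofReal (Real.exp (s * (medMean ν a (mediator z) - armMean ν a)))), h1, mul_comm]
    · gcongr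
      rw [hν.armMean_eq_integral a]
      exact lintegral_exp_centred_le (measurable_medMean_mediator a)
        (fun z => hν.medMean_mem a (mediator z)) s
    · intro z hz
      have hz' : mediatorSeen z = true := hz
      simp [mediatorNoise, hz']
  · rw [setLIntegral_congr_fun hmeas (g := fun _ => 1)]
    · simp only [lintegral_const, one_mul, Measure.restrict_apply_univ]
      refine le_mul_of_one_le_left (zero_le) ?_
      rw [ENNReal.one_le_ofReal]
      exact Real.one_le_exp (by positivity)
    · intro z hz
      have hz' : mediatorSeen z = om := hz
      simp [mediatorNoise, hz', h]

theorem measureReal_mediator_and_mediatorSeen (a : Fin n) (m : Fin k) :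
    (ν a).real {z | mediator z = m ∧ mediatorSeen z = true} =
      medProb ν a m * medSeenProb ν a := by
  have := hν.isProb a
  have h := (hν.indep_mediatorSeen_mediator a).symm.measure_inter_preimage_eq_mul {m} {true}
    (measurableSet_singleton m) (measurableSet_singleton true)
  rw [medProb, medSeenProb, measureReal_def, measureReal_def, measureReal_def,
    ← ENNReal.toReal_mul]
  exact congrArg ENNReal.toReal h

theorem measureReal_all_seen (a : Fin n) (m : Fin k) :
    (ν a).real {z | (mediator z = m ∧ mediatorSeen z = true) ∧ outcomeSeen z = true} =
      medProb ν a m * (outSeenProbOfMedSeen ν a m * medSeenProb ν a) := by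
  have := hν.isProb a
  have h := cond_mul_eq_inter (μ := ν a)
    ((measurableSet_mediator m).inter measurableSet_mediatorSeen) {z | outcomeSeen z = true}
  have h' := congrArg ENNReal.toReal h
  rw [ENNReal.toReal_mul] at h'
  have h2 := hν.measureReal_mediator_and_mediatorSeen a m
  calc _ = outSeenProbOfMedSeen ν a m *
        (ν a).real {z | mediator z = m ∧ mediatorSeen z = true} := h'.symm
    _ = _ := by rw [h2]; ring

/-- If the two missingness indicators are independent given the mediator, then observing the
mediator does not change the probability of observing the outcome. -/
theorem outSeenProbOfMedSeen_eq
    (hind : ∀ a m, IndepFun mediatorSeen outcomeSeen (lawGivenMed ν a m)) :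
    outSeenProbOfMedSeen ν = outSeenProb ν := by
  funext a m
  have := hν.isProb a
  have hm := measurableSet_mediator (k := k) m
  have h := (hind a m).measure_inter_preimage_eq_mul {true} {true}
    (measurableSet_singleton _) (measurableSet_singleton _)
  have hpos : 0 < (ν a).real {z | mediator z = m ∧ mediatorSeen z = true} := by
    rw [hν.measureReal_mediator_and_mediatorSeen]
    exact mul_pos (hν.medProb_pos a m) (hν.medSeenProb_pos a)
  have hpos' : ν a ({z | mediator z = m} ∩ {z | mediatorSeen z = true}) ≠ 0 := fun h0 => by
    rw [measureReal_def] at hpos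
    exact hpos.ne' (by rw [ENNReal.toReal_eq_zero_iff]; exact Or.inl h0)
  have h1 : lawGivenMed ν a m {z | mediatorSeen z = true} ≠ 0 := by
    rw [lawGivenMed, cond_apply hm]
    exact mul_ne_zero (ENNReal.inv_ne_zero.2 (measure_ne_top _ _)) hpos'
  have h2 : ProbabilityTheory.cond (ν a) {z | mediator z = m ∧ mediatorSeen z = true} =
      ProbabilityTheory.cond (lawGivenMed ν a m) {z | mediatorSeen z = true} :=
    (cond_cond_eq_cond_inter hm measurableSet_mediatorSeen (ν a)).symm
  rw [outSeenProbOfMedSeen, outSeenProb, measureReal_def, measureReal_def, h2,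
    cond_apply measurableSet_mediatorSeen]
  congr 1
  have h3 : lawGivenMed ν a m ({z | mediatorSeen z = true} ∩ {z | outcomeSeen z = true}) =
    lawGivenMed ν a m {z | mediatorSeen z = true} *
      lawGivenMed ν a m {z | outcomeSeen z = true} := h
  rw [h3, ← mul_assoc, ENNReal.inv_mul_cancel h1, one_mul]
  have : IsFiniteMeasure (lawGivenMed ν a m) := by unfold lawGivenMed; infer_instance
  exact measure_ne_top _ _

end IsMARInstance

end Arm

/-! ### The statistics of one arm as functions of its own draws -/

section Solo

variable {n k : ℕ}

/-- The history of an agent that pulls only the arm `a`, with the draws `z 0, z 1, …`. -/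
def soloHistory (a : Fin n) (z : ℕ → Draw k) : History n k := fun s => (a, observe (z s))

variable (a : Fin n) (z : ℕ → Draw k) (N : ℕ) (m : Fin k)

theorem observe_snd_isSome (y : Draw k) : (observe y).2.isSome = true ↔ mediatorSeen y = true := by
  by_cases h : mediatorSeen y = true <;> simp [observe, h]

theorem observe_snd_eq_some (y : Draw k) :
    (observe y).2 = some m ↔ mediator y = m ∧ mediatorSeen y = true := by
  by_cases h : mediatorSeen y = true <;> simp [observe, h]

theorem observe_fst_isSome (y : Draw k) : (observe y).1.isSome = true ↔ outcomeSeen y = true := by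
  by_cases h : outcomeSeen y = true <;> simp [observe, h]

theorem pullsSeen_soloHistory : pullsSeen (soloHistory a z) N a =
    ((Finset.range N).filter fun i => mediatorSeen (z i) = true).card := by
  unfold pullsSeen
  congr 1
  ext i
  simp [soloHistory, observe_snd_isSome]

theorem medCount_soloHistory : medCount (soloHistory a z) N a m =
    ((Finset.range N).filter fun i => mediator (z i) = m ∧ mediatorSeen (z i) = true).card := by
  unfold medCount
  congr 1
  ext i
  simp [soloHistory, observe_snd_eq_some]

theorem rewardRounds_soloHistory : rewardRounds (soloHistory a z) N a m =
    (Finset.range N).filter fun i =>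
      (mediator (z i) = m ∧ mediatorSeen (z i) = true) ∧ outcomeSeen (z i) = true := by
  unfold rewardRounds
  ext i
  simp [soloHistory, observe_snd_eq_some, observe_fst_isSome, and_assoc]

theorem rewardCount_soloHistory : rewardCount (soloHistory a z) N a m =
    ((Finset.range N).filter fun i =>
      (mediator (z i) = m ∧ mediatorSeen (z i) = true) ∧ outcomeSeen (z i) = true).card := by
  rw [rewardCount, rewardRounds_soloHistory]

theorem card_filter_range_eq_sum_indicator (p : Draw k → Prop) [DecidablePred p]
    {B : Set (Draw k)} (hB : ∀ y, y ∈ B ↔ p y) :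
    (((Finset.range N).filter fun i => p (z i)).card : ℝ) =
      ∑ i : Fin N, B.indicator 1 (z i) := by
  rw [← Finset.sum_range (n := N) (fun i => B.indicator (1 : Draw k → ℝ) (z i)),
    Finset.card_filter]
  push_cast
  refine Finset.sum_congr rfl fun i _ => ?_
  by_cases h : p (z i) <;> simp [hB, h]

theorem rewardCount_le_medCount :
    rewardCount (soloHistory a z) N a m ≤ medCount (soloHistory a z) N a m := by
  rw [rewardCount_soloHistory, medCount_soloHistory]
  exact Finset.card_le_card fun i hi => by
    simp only [Finset.mem_filter] at hi ⊢
    exact ⟨hi.1, hi.2.1⟩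

theorem sum_filter_mediatorSeen (f : ℕ → ℝ) :
    ∑ i ∈ (Finset.range N).filter (fun i => mediatorSeen (z i) = true), f i =
      ∑ m, ∑ i ∈ (Finset.range N).filter
        (fun i => mediator (z i) = m ∧ mediatorSeen (z i) = true), f i := by
  rw [← Finset.sum_fiberwise _ (fun i => mediator (z i))]
  refine Finset.sum_congr rfl fun m _ => ?_
  rw [Finset.filter_filter]
  simp_rw [and_comm]

theorem sum_medCount :
    ∑ m, (medCount (soloHistory a z) N a m : ℝ) = pullsSeen (soloHistory a z) N a := by
  have h := sum_filter_mediatorSeen z N (fun _ => 1)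
  simp only [Finset.sum_const, nsmul_eq_mul, mul_one] at h
  simp_rw [medCount_soloHistory, pullsSeen_soloHistory]
  exact h.symm

theorem sum_ite_seen (f : ℕ → ℝ) :
    ∑ i ∈ Finset.range N,
        (if outcomeSeen (z i) = true ∧ mediatorSeen (z i) = true then f i else 0) =
      ∑ m, ∑ i ∈ rewardRounds (soloHistory a z) N a m, f i := by
  rw [← Finset.sum_filter, ← Finset.sum_fiberwise _ (fun i => mediator (z i))]
  refine Finset.sum_congr rfl fun m _ => ?_
  rw [Finset.filter_filter, rewardRounds_soloHistory]
  refine Finset.sum_congr (Finset.filter_congr fun i _ => ?_) fun _ _ => rfl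
  tauto

/-- The weight of the `i`-th draw in the estimate of the arm mean: `\hat p_m / T_{m,a,o}` if the
mediator is observed to be `m` and the outcome is observed, and `0` otherwise. -/
noncomputable def rewardWeight (i : ℕ) : ℝ :=
  if outcomeSeen (z i) = true ∧ mediatorSeen (z i) = true then
    medProbHat (soloHistory a z) N a (mediator (z i)) /
      rewardCount (soloHistory a z) N a (mediator (z i))
  else 0

/-- The weight of the `i`-th draw in the empirical law of the mediator: `1 / T_a` if the mediator
is observed, and `0` otherwise. -/
noncomputable def mediatorWeight (i : ℕ) : ℝ :=
  if mediatorSeen (z i) = true then 1 / (pullsSeen (soloHistory a z) N a : ℝ) else 0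

/-- The variance proxy `∑_m \hat p_{m,a}² / T_{m,a,o}` in the index. -/
noncomputable def varianceProxy (h : History n k) (t : ℕ) (a : Fin n) : ℝ :=
  ∑ m, medProbHat h t a m ^ 2 / (rewardCount h t a m : ℝ)

theorem varianceProxy_nonneg (h : History n k) (t : ℕ) (a : Fin n) : 0 ≤ varianceProxy h t a :=
  Finset.sum_nonneg fun _ _ => by positivity

theorem mediator_of_mem_rewardRounds {i : ℕ} (hi : i ∈ rewardRounds (soloHistory a z) N a m) :
    mediator (z i) = m ∧ mediatorSeen (z i) = true ∧ outcomeSeen (z i) = true := by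
  rw [rewardRounds_soloHistory, Finset.mem_filter] at hi
  tauto

theorem sum_rewardWeight_sq :
    ∑ i : Fin N, rewardWeight a z N i ^ 2 = varianceProxy (soloHistory a z) N a := by
  rw [← Finset.sum_range (fun i => rewardWeight a z N i ^ 2)]
  have h1 : ∀ i, rewardWeight a z N i ^ 2 =
      if outcomeSeen (z i) = true ∧ mediatorSeen (z i) = true then
        (medProbHat (soloHistory a z) N a (mediator (z i)) /
          rewardCount (soloHistory a z) N a (mediator (z i))) ^ 2 else 0 := fun i => by
    unfold rewardWeight
    split_ifs <;> simp
  simp_rw [h1]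
  rw [sum_ite_seen a z N, varianceProxy]
  refine Finset.sum_congr rfl fun m _ => ?_
  rw [Finset.sum_congr rfl (g := fun _ => (medProbHat (soloHistory a z) N a m /
    rewardCount (soloHistory a z) N a m) ^ 2) fun i hi => by
      rw [(mediator_of_mem_rewardRounds a z N m hi).1], Finset.sum_const, nsmul_eq_mul]
  change (rewardCount (soloHistory a z) N a m : ℝ) * _ = _
  by_cases h0 : (rewardCount (soloHistory a z) N a m : ℝ) = 0
  · simp [h0]
  · field_simp

theorem sum_mediatorWeight_sq :
    ∑ i : Fin N, mediatorWeight a z N i ^ 2 = 1 / (pullsSeen (soloHistory a z) N a : ℝ) := by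
  rw [← Finset.sum_range (fun i => mediatorWeight a z N i ^ 2)]
  have h1 : ∀ i, mediatorWeight a z N i ^ 2 = if mediatorSeen (z i) = true then
      (1 / (pullsSeen (soloHistory a z) N a : ℝ)) ^ 2 else 0 := fun i => by
    unfold mediatorWeight
    split_ifs <;> simp
  simp_rw [h1]
  rw [← Finset.sum_filter, Finset.sum_const, ← pullsSeen_soloHistory a, nsmul_eq_mul]
  by_cases h0 : (pullsSeen (soloHistory a z) N a : ℝ) = 0
  · simp [h0]
  · field_simp

variable (ν : Fin n → Measure (Draw k))

theorem sum_rewardWeight_mul_rewardNoise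
    (hpos : ∀ m, 0 < rewardCount (soloHistory a z) N a m) :
    ∑ i : Fin N, rewardWeight a z N i * rewardNoise ν a (z i) =
      ∑ m, medProbHat (soloHistory a z) N a m *
        (medMeanHat (soloHistory a z) N a m - medMean ν a m) := by
  rw [← Finset.sum_range (fun i => rewardWeight a z N i * rewardNoise ν a (z i))]
  have h1 : ∀ i, rewardWeight a z N i * rewardNoise ν a (z i) =
      if outcomeSeen (z i) = true ∧ mediatorSeen (z i) = true then
        medProbHat (soloHistory a z) N a (mediator (z i)) /
          rewardCount (soloHistory a z) N a (mediator (z i)) *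
          (outcome (z i) - medMean ν a (mediator (z i))) else 0 := fun i => by
    unfold rewardWeight rewardNoise
    split_ifs <;> simp
  simp_rw [h1]
  rw [sum_ite_seen a z N]
  refine Finset.sum_congr rfl fun m _ => ?_
  have h2 : ∀ i ∈ rewardRounds (soloHistory a z) N a m,
      medProbHat (soloHistory a z) N a (mediator (z i)) /
          rewardCount (soloHistory a z) N a (mediator (z i)) *
          (outcome (z i) - medMean ν a (mediator (z i))) =
      medProbHat (soloHistory a z) N a m / rewardCount (soloHistory a z) N a m *
        (((soloHistory a z i).2.1).getD 0 - medMean ν a m) := fun i hi => by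
    obtain ⟨e1, -, e3⟩ := mediator_of_mem_rewardRounds a z N m hi
    simp [e1, soloHistory, observe, e3]
  have hc : (rewardCount (soloHistory a z) N a m : ℝ) ≠ 0 := by
    exact_mod_cast (hpos m).ne'
  rw [Finset.sum_congr rfl h2, ← Finset.mul_sum, Finset.sum_sub_distrib, Finset.sum_const,
    nsmul_eq_mul]
  change _ * (_ - (rewardCount (soloHistory a z) N a m : ℝ) * _) = _
  rw [medMeanHat]
  field_simp

theorem sum_mediatorWeight_mul_mediatorNoise (hpos : 0 < pullsSeen (soloHistory a z) N a) :
    ∑ i : Fin N, mediatorWeight a z N i * mediatorNoise ν a (z i) =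
      ∑ m, medProbHat (soloHistory a z) N a m * medMean ν a m - armMean ν a := by
  rw [← Finset.sum_range (fun i => mediatorWeight a z N i * mediatorNoise ν a (z i))]
  have h1 : ∀ i, mediatorWeight a z N i * mediatorNoise ν a (z i) =
      if mediatorSeen (z i) = true then
        1 / (pullsSeen (soloHistory a z) N a : ℝ) * (medMean ν a (mediator (z i)) - armMean ν a)
      else 0 := fun i => by
    unfold mediatorWeight mediatorNoise
    split_ifs <;> simp
  have hc : (pullsSeen (soloHistory a z) N a : ℝ) ≠ 0 := by exact_mod_cast hpos.ne'
  simp_rw [h1]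
  rw [← Finset.sum_filter, ← Finset.mul_sum, Finset.sum_sub_distrib, Finset.sum_const,
    ← pullsSeen_soloHistory a, nsmul_eq_mul, sum_filter_mediatorSeen]
  have h2 : ∀ m, ∑ i ∈ (Finset.range N).filter
        (fun i => mediator (z i) = m ∧ mediatorSeen (z i) = true), medMean ν a (mediator (z i)) =
      medCount (soloHistory a z) N a m * medMean ν a m := fun m => by
    rw [Finset.sum_congr rfl (g := fun _ => medMean ν a m) fun i hi => by
      rw [(Finset.mem_filter.1 hi).2.1], Finset.sum_const, nsmul_eq_mul, medCount_soloHistory]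
  simp_rw [h2, medProbHat, div_mul_eq_mul_div]
  rw [← Finset.sum_div]
  field_simp

/-- The variance proxy of the index dominates that of the empirical law of the mediator, since
`T_{m,a,o} ≤ s_{m,a}`. -/
theorem inv_pullsSeen_le_varianceProxy (hpos : ∀ m, 0 < rewardCount (soloHistory a z) N a m) :
    1 / (pullsSeen (soloHistory a z) N a : ℝ) ≤ varianceProxy (soloHistory a z) N a := by
  set S : ℝ := ((pullsSeen (soloHistory a z) N a : ℕ) : ℝ) with hS
  have h1 : 1 / S = ∑ m, (medCount (soloHistory a z) N a m : ℝ) / S ^ 2 := by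
    rw [← Finset.sum_div, sum_medCount]
    by_cases h0 : S = 0
    · simp [h0]
    · rw [← hS]; field_simp
  rw [h1, varianceProxy]
  refine Finset.sum_le_sum fun m _ => ?_
  have ho : (0 : ℝ) < rewardCount (soloHistory a z) N a m := by exact_mod_cast hpos m
  have hle : (rewardCount (soloHistory a z) N a m : ℝ) ≤ medCount (soloHistory a z) N a m := by
    exact_mod_cast rewardCount_le_medCount a z N m
  rw [medProbHat, ← hS, div_pow, div_div, mul_comm, ← div_div]
  gcongr
  rw [le_div_iff₀ ho, sq]
  gcongr

end Solo

/-! ### Accuracy of the estimates on a typical sample -/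

section Typical

variable {n k : ℕ} (ν : Fin n → Measure (Draw k))

/-- A sample of `N` draws of arm `a` is typical at accuracy levels `q` and `x` if the three kinds
of counts are within `N q / 2` of their expectations, and the two noise sums are at most `x` times
the norms of their weight vectors. -/
structure IsTypical (q x : ℝ) (a : Fin n) (N : ℕ) (z : ℕ → Draw k) : Prop where
  pullsSeen : |(pullsSeen (soloHistory a z) N a : ℝ) - N * medSeenProb ν a| ≤ N * q / 2
  medCount : ∀ m, |(medCount (soloHistory a z) N a m : ℝ) -
    N * (medProb ν a m * medSeenProb ν a)| ≤ N * q / 2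
  rewardCount : ∀ m, |(rewardCount (soloHistory a z) N a m : ℝ) -
    N * (medProb ν a m * (outSeenProbOfMedSeen ν a m * medSeenProb ν a))| ≤ N * q / 2
  reward : |∑ i : Fin N, rewardWeight a z N i * rewardNoise ν a (z i)| ≤
    x * √(∑ i : Fin N, rewardWeight a z N i ^ 2)
  mediator : |∑ i : Fin N, mediatorWeight a z N i * mediatorNoise ν a (z i)| ≤
    x * √(∑ i : Fin N, mediatorWeight a z N i ^ 2)

theorem outSeenProbOfMedSeen_le_one {a : Fin n} (m : Fin k) :
    outSeenProbOfMedSeen ν a m ≤ 1 := measureReal_le_one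

variable {ν}

theorem one_le_armComplexity (hν : IsMARInstance ν) (a : Fin n) :
    1 ≤ armComplexity ν (outSeenProbOfMedSeen ν) a := by
  have := hν.isProb a
  rw [armComplexity, ← hν.sum_medProb a]
  refine Finset.sum_le_sum fun m _ => ?_
  rw [le_div_iff₀ (mul_pos (hν.outSeenProb_pos a m) (hν.medSeenProb_pos a))]
  refine mul_le_of_le_one_right (hν.medProb_pos a m).le ?_
  exact mul_le_one₀ (outSeenProbOfMedSeen_le_one ν m) (hν.medSeenProb_pos a).le
    measureReal_le_one

section Consequences

variable {q x : ℝ} {a : Fin n} {N : ℕ} {z : ℕ → Draw k}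

theorem IsTypical.rewardCount_ge (h : IsTypical ν q x a N z)
    (hq : ∀ m, q ≤ medProb ν a m * (outSeenProbOfMedSeen ν a m * medSeenProb ν a)) (m : Fin k) :
    N * (medProb ν a m * (outSeenProbOfMedSeen ν a m * medSeenProb ν a)) / 2 ≤
      MissingBandit.rewardCount (soloHistory a z) N a m := by
  have h1 := (abs_le.1 (h.rewardCount m)).1
  have h2 : N * q ≤ N * (medProb ν a m * (outSeenProbOfMedSeen ν a m * medSeenProb ν a)) := by
    gcongr
    exact hq m
  linarith

theorem IsTypical.rewardCount_pos (h : IsTypical ν q x a N z) (hq0 : 0 < q) (hN : 0 < N)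
    (hq : ∀ m, q ≤ medProb ν a m * (outSeenProbOfMedSeen ν a m * medSeenProb ν a)) (m : Fin k) :
    0 < MissingBandit.rewardCount (soloHistory a z) N a m := by
  have h1 := h.rewardCount_ge hq m
  have hN' : (0 : ℝ) < N := by exact_mod_cast hN
  have h2 := mul_pos hN' (hq0.trans_le (hq m))
  have : (0 : ℝ) < MissingBandit.rewardCount (soloHistory a z) N a m := by linarith
  exact_mod_cast this

theorem q_le_medProb_mul (hν : IsMARInstance ν)
    (hq : ∀ m, q ≤ medProb ν a m * (outSeenProbOfMedSeen ν a m * medSeenProb ν a)) (m : Fin k) :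
    q ≤ medProb ν a m * medSeenProb ν a := by
  have h1 := hν.medSeenProb_pos a
  refine (hq m).trans ?_
  gcongr
  · exact (hν.medProb_pos a m).le
  · exact mul_le_of_le_one_left h1.le (outSeenProbOfMedSeen_le_one ν m)

theorem q_le_medSeenProb (hν : IsMARInstance ν)
    (hq : ∀ m, q ≤ medProb ν a m * (outSeenProbOfMedSeen ν a m * medSeenProb ν a)) (m : Fin k) :
    q ≤ medSeenProb ν a := by
  have := hν.isProb a
  exact (q_le_medProb_mul hν hq m).trans
    (mul_le_of_le_one_left (hν.medSeenProb_pos a).le measureReal_le_one)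

theorem IsTypical.pullsSeen_ge [NeZero k] (h : IsTypical ν q x a N z) (hν : IsMARInstance ν)
    (hq : ∀ m, q ≤ medProb ν a m * (outSeenProbOfMedSeen ν a m * medSeenProb ν a)) :
    N * medSeenProb ν a / 2 ≤ MissingBandit.pullsSeen (soloHistory a z) N a := by
  have h1 := (abs_le.1 h.pullsSeen).1
  have h2 : N * q ≤ N * medSeenProb ν a := by
    gcongr
    exact q_le_medSeenProb hν hq 0
  linarith

theorem IsTypical.pullsSeen_pos [NeZero k] (h : IsTypical ν q x a N z) (hν : IsMARInstance ν)
    (hN : 0 < N)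
    (hq : ∀ m, q ≤ medProb ν a m * (outSeenProbOfMedSeen ν a m * medSeenProb ν a)) :
    0 < MissingBandit.pullsSeen (soloHistory a z) N a := by
  have h1 := h.pullsSeen_ge hν hq
  have hN' : (0 : ℝ) < N := by exact_mod_cast hN
  have h2 := mul_pos hN' (hν.medSeenProb_pos a)
  have : (0 : ℝ) < MissingBandit.pullsSeen (soloHistory a z) N a := by linarith
  exact_mod_cast this

/-- On a typical sample the empirical mediator law is at most four times the true one. -/
theorem IsTypical.medProbHat_le [NeZero k] (h : IsTypical ν q x a N z) (hν : IsMARInstance ν)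
    (hN : 0 < N)
    (hq : ∀ m, q ≤ medProb ν a m * (outSeenProbOfMedSeen ν a m * medSeenProb ν a)) (m : Fin k) :
    medProbHat (soloHistory a z) N a m ≤ 4 * medProb ν a m := by
  have h1 := (abs_le.1 (h.medCount m)).2
  have h2 : N * q ≤ N * (medProb ν a m * medSeenProb ν a) := by
    gcongr
    exact q_le_medProb_mul hν hq m
  have hS : (0 : ℝ) < MissingBandit.pullsSeen (soloHistory a z) N a := by
    exact_mod_cast h.pullsSeen_pos hν hN hq
  have hp := hν.medProb_pos a m
  rw [medProbHat, div_le_iff₀ hS]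
  have h3 := mul_le_mul_of_nonneg_left (h.pullsSeen_ge hν hq) hp.le
  have h4 : 0 ≤ N * (medProb ν a m * medSeenProb ν a) := by
    have := hν.medSeenProb_pos a
    positivity
  nlinarith

theorem IsTypical.varianceProxy_le [NeZero k] (h : IsTypical ν q x a N z) (hν : IsMARInstance ν)
    (hN : 0 < N)
    (hq : ∀ m, q ≤ medProb ν a m * (outSeenProbOfMedSeen ν a m * medSeenProb ν a)) :
    varianceProxy (soloHistory a z) N a ≤
      32 * armComplexity ν (outSeenProbOfMedSeen ν) a / N := by
  have hN' : (0 : ℝ) < N := by exact_mod_cast hN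
  rw [varianceProxy, armComplexity, Finset.mul_sum, Finset.sum_div]
  refine Finset.sum_le_sum fun m _ => ?_
  have hp := hν.medProb_pos a m
  have hl := hν.medSeenProb_pos a
  have hg := hν.outSeenProb_pos a m
  have hp0 : 0 ≤ medProbHat (soloHistory a z) N a m := by unfold medProbHat; positivity
  calc medProbHat (soloHistory a z) N a m ^ 2 / MissingBandit.rewardCount (soloHistory a z) N a m
      ≤ (4 * medProb ν a m) ^ 2 /
        (N * (medProb ν a m * (outSeenProbOfMedSeen ν a m * medSeenProb ν a)) / 2) := by
        gcongr
        · exact h.medProbHat_le hν hN hq m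
        · exact h.rewardCount_ge hq m
    _ = _ := by
        field_simp
        norm_num

theorem IsTypical.abs_armMeanHat_sub_le [NeZero k] (h : IsTypical ν q x a N z)
    (hν : IsMARInstance ν) (hq0 : 0 < q) (hx : 0 ≤ x) (hN : 0 < N)
    (hq : ∀ m, q ≤ medProb ν a m * (outSeenProbOfMedSeen ν a m * medSeenProb ν a)) :
    |armMeanHat (soloHistory a z) N a - armMean ν a| ≤
      2 * x * √(varianceProxy (soloHistory a z) N a) := by
  have hpos := h.rewardCount_pos hq0 hN hq
  have h1 := h.reward
  have h2 := h.mediator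
  rw [sum_rewardWeight_sq, sum_rewardWeight_mul_rewardNoise a z N ν hpos] at h1
  rw [sum_mediatorWeight_sq,
    sum_mediatorWeight_mul_mediatorNoise a z N ν (h.pullsSeen_pos hν hN hq)] at h2
  have h3 : x * √(1 / (MissingBandit.pullsSeen (soloHistory a z) N a : ℝ)) ≤
      x * √(varianceProxy (soloHistory a z) N a) := by
    gcongr
    exact inv_pullsSeen_le_varianceProxy a z N hpos
  have h4 : armMeanHat (soloHistory a z) N a - armMean ν a =
      ∑ m, medProbHat (soloHistory a z) N a m *
        (medMeanHat (soloHistory a z) N a m - medMean ν a m) +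
      (∑ m, medProbHat (soloHistory a z) N a m * medMean ν a m - armMean ν a) := by
    rw [armMeanHat]
    simp_rw [mul_sub]
    rw [Finset.sum_sub_distrib]
    ring
  rw [h4]
  refine (abs_add_le _ _).trans ?_
  linarith

end Consequences

/-! ### Typical samples are likely -/

section Probability

variable {Ω : Type*} [MeasurableSpace Ω] {P : Measure Ω} {X : Fin n → ℕ → Ω → Draw k}

/-- The weights of the reward noise are functions of the statuses of the first `N` draws. -/
theorem rewardWeight_congr (a : Fin n) {N : ℕ} {z z' : ℕ → Draw k}
    (h : ∀ i : Fin N, status (z i) = status (z' i)) (i : Fin N) :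
    rewardWeight a z N i = rewardWeight a z' N i := by
  have e : ∀ j ∈ Finset.range N, outcomeSeen (z j) = outcomeSeen (z' j) ∧
      mediator (z j) = mediator (z' j) ∧ mediatorSeen (z j) = mediatorSeen (z' j) := by
    intro j hj
    have := h ⟨j, Finset.mem_range.1 hj⟩
    simp only [status] at this
    simp [outcomeSeen, mediator, mediatorSeen, this]
  have h1 : pullsSeen (soloHistory a z) N a = pullsSeen (soloHistory a z') N a := by
    simp_rw [pullsSeen_soloHistory]
    congr 1
    exact Finset.filter_congr fun j hj => by rw [(e j hj).2.2]
  have h2 : ∀ m, medCount (soloHistory a z) N a m = medCount (soloHistory a z') N a m := fun m => by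
    simp_rw [medCount_soloHistory]
    congr 1
    exact Finset.filter_congr fun j hj => by rw [(e j hj).2.2, (e j hj).2.1]
  have h3 : ∀ m, rewardCount (soloHistory a z) N a m = rewardCount (soloHistory a z') N a m :=
    fun m => by
      simp_rw [rewardCount_soloHistory]
      congr 1
      exact Finset.filter_congr fun j hj => by rw [(e j hj).2.2, (e j hj).2.1, (e j hj).1]
  have hi := e i (Finset.mem_range.2 i.2)
  simp only [rewardWeight, medProbHat, h1, h2, h3, hi.1, hi.2.1, hi.2.2]

theorem mediatorWeight_congr (a : Fin n) {N : ℕ} {z z' : ℕ → Draw k}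
    (h : ∀ i : Fin N, mediatorSeen (z i) = mediatorSeen (z' i)) (i : Fin N) :
    mediatorWeight a z N i = mediatorWeight a z' N i := by
  have h1 : pullsSeen (soloHistory a z) N a = pullsSeen (soloHistory a z') N a := by
    simp_rw [pullsSeen_soloHistory]
    congr 1
    exact Finset.filter_congr fun j hj => by rw [h ⟨j, Finset.mem_range.1 hj⟩]
  simp only [mediatorWeight, h1, h i]

theorem iIndepFun_firstDraws (hX : IsDrawTable ν P X) (a : Fin n) (N : ℕ) :
    iIndepFun (fun i : Fin N => X a i) P :=
  hX.indep.precomp (g := fun i : Fin N => (a, (i : ℕ))) fun i j hij => by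
    simpa [Fin.ext_iff] using hij

/-- The union bound over the `2 k + 1` counts and the two noise sums. -/
theorem measure_not_isTypical_le (hν : IsMARInstance ν) (hX : IsDrawTable ν P X) (a : Fin n)
    (N : ℕ) {q x : ℝ} (hq : 0 ≤ q) (hx : 0 ≤ x) :
    P {ω | ¬ IsTypical ν q x a N fun i => X a i ω} ≤
      (2 * k + 1) * (2 * ENNReal.ofReal (Real.exp (-(N * q ^ 2 / 8)))) +
        2 * (2 * ENNReal.ofReal (Real.exp (-(x ^ 2 / 2)))) := by
  have := hν.isProb a
  have hind := iIndepFun_firstDraws hX a N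
  have hmeas : ∀ i : Fin N, Measurable (X a i) := fun i => hX.measurable a i
  have hlaw : ∀ i : Fin N, P.map (X a i) = ν a := fun i => hX.law a i
  -- Deviation `N q / 2 = y √N` for `y = √N q / 2`.
  have hcount : ∀ (B : Set (Draw k)) (p : ℝ) (c : Ω → ℕ), MeasurableSet B → (ν a).real B = p →
      (∀ ω, (c ω : ℝ) = ∑ i : Fin N, B.indicator 1 (X a i ω)) →
      P {ω | ¬ |(c ω : ℝ) - N * p| ≤ N * q / 2} ≤
        2 * ENNReal.ofReal (Real.exp (-(N * q ^ 2 / 8))) := by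
    intro B p c hB hp hc
    have h := measure_abs_card_sub_gt_le hmeas hlaw hind hB (x := √N * q / 2) (by positivity)
    have hs : √(N : ℝ) * √N = N := Real.mul_self_sqrt (Nat.cast_nonneg N)
    have e1 : √N * q / 2 * √N = N * q / 2 := by linear_combination q / 2 * hs
    have e2 : (√N * q / 2) ^ 2 / 2 = N * q ^ 2 / 8 := by linear_combination q ^ 2 / 8 * hs
    rw [e1, e2, hp] at h
    simpa only [hc, not_le] using h
  have h1 : P {ω | ¬ |(pullsSeen (soloHistory a fun i => X a i ω) N a : ℝ) -
      N * medSeenProb ν a| ≤ N * q / 2} ≤ 2 * ENNReal.ofReal (Real.exp (-(N * q ^ 2 / 8))) :=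
    hcount _ _ _ measurableSet_mediatorSeen rfl fun ω => by
      rw [pullsSeen_soloHistory]
      exact card_filter_range_eq_sum_indicator (fun i => X a i ω) N
        (fun y => mediatorSeen y = true) fun _ => Iff.rfl
  have h2 : ∀ m, P {ω | ¬ |(medCount (soloHistory a fun i => X a i ω) N a m : ℝ) -
      N * (medProb ν a m * medSeenProb ν a)| ≤ N * q / 2} ≤
        2 * ENNReal.ofReal (Real.exp (-(N * q ^ 2 / 8))) := fun m =>
    hcount _ _ _ ((measurableSet_mediator m).inter measurableSet_mediatorSeen)
      (hν.measureReal_mediator_and_mediatorSeen a m) fun ω => by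
      rw [medCount_soloHistory]
      exact card_filter_range_eq_sum_indicator (fun i => X a i ω) N
        (fun y => mediator y = m ∧ mediatorSeen y = true) fun _ => Iff.rfl
  have h3 : ∀ m, P {ω | ¬ |(rewardCount (soloHistory a fun i => X a i ω) N a m : ℝ) -
      N * (medProb ν a m * (outSeenProbOfMedSeen ν a m * medSeenProb ν a))| ≤ N * q / 2} ≤
        2 * ENNReal.ofReal (Real.exp (-(N * q ^ 2 / 8))) := fun m =>
    hcount _ _ _ (((measurableSet_mediator m).inter measurableSet_mediatorSeen).inter
      measurableSet_outcomeSeen) (hν.measureReal_all_seen a m) fun ω => by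
      rw [rewardCount_soloHistory]
      exact card_filter_range_eq_sum_indicator (fun i => X a i ω) N
        (fun y => (mediator y = m ∧ mediatorSeen y = true) ∧ outcomeSeen y = true) fun _ => Iff.rfl
  have h4 := (hν.subgaussianOnFibers_rewardNoise a).measure_abs_sum_gt_le measurable_status
    (measurable_rewardNoise a) hmeas hlaw hind
    (fun ω i => rewardWeight a (fun i => X a i ω) N i)
    (fun ω ω' h => funext fun i => rewardWeight_congr a h i) hx
  have h5 := (hν.subgaussianOnFibers_mediatorNoise a).measure_abs_sum_gt_le
    measurable_mediatorSeen (measurable_mediatorNoise a) hmeas hlaw hind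
    (fun ω i => mediatorWeight a (fun i => X a i ω) N i)
    (fun ω ω' h => funext fun i => mediatorWeight_congr a h i) hx
  set δ := 2 * ENNReal.ofReal (Real.exp (-(N * q ^ 2 / 8)))
  set η := 2 * ENNReal.ofReal (Real.exp (-(x ^ 2 / 2)))
  have h2' := (measure_iUnion_fintype_le P _).trans
    (Finset.sum_le_sum fun m (_ : m ∈ Finset.univ) => h2 m)
  have h3' := (measure_iUnion_fintype_le P _).trans
    (Finset.sum_le_sum fun m (_ : m ∈ Finset.univ) => h3 m)
  rw [Finset.sum_const, Finset.card_univ, Fintype.card_fin, nsmul_eq_mul] at h2' h3'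
  refine (measure_mono ?_).trans <| (measure_union_le _ _).trans <| (add_le_add
    ((measure_union_le _ _).trans <| add_le_add
      ((measure_union_le _ _).trans (add_le_add h1 h2')) h3')
    ((measure_union_le _ _).trans (add_le_add h4 h5))).trans (le_of_eq (by ring))
  intro ω hω
  by_contra hcon
  simp only [Set.mem_union, Set.mem_iUnion, Set.mem_ofPred_eq, not_or, not_exists, not_not,
    not_lt] at hcon
  exact hω ⟨hcon.1.1.1, hcon.1.1.2, hcon.1.2, hcon.2.1, hcon.2.2⟩

end Probability

end Typical

/-! ### The statistics of an arm along a run -/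

section Run

variable {n k : ℕ} {Ω : Type*} (X : Fin n → ℕ → Ω → Draw k) (A : ℕ → Ω → Fin n) (ω : Ω)

theorem pulls_succ (a : Fin n) (t : ℕ) :
    pulls A a (t + 1) ω = pulls A a t ω + if A t ω = a then 1 else 0 := by
  unfold pulls
  rw [Finset.range_add_one, Finset.filter_insert]
  split_ifs with h
  · rw [Finset.card_insert_of_notMem (by simp)]
  · rfl

/-- The rounds in which arm `a` is pulled enumerate the draws of that arm. -/
theorem sum_filter_pulls {R : Type*} [AddCommMonoid R] (a : Fin n) (f : ℕ → R) (t : ℕ) :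
    ∑ s ∈ (Finset.range t).filter (fun s => A s ω = a), f (pulls A a s ω) =
      ∑ i ∈ Finset.range (pulls A a t ω), f i := by
  induction t with
  | zero => simp [pulls]
  | succ t ih =>
    rw [pulls_succ, Finset.range_add_one, Finset.filter_insert]
    split_ifs with h
    · rw [Finset.sum_insert (by simp), ih, Finset.sum_range_succ, add_comm]
    · simpa using ih

theorem pulls_le (a : Fin n) (t : ℕ) : pulls A a t ω ≤ t :=
  (Finset.card_filter_le _ _).trans (by simp)

theorem sum_pulls (t : ℕ) : ∑ a, pulls A a t ω = t := by
  have := Finset.card_eq_sum_card_fiberwise (f := fun s => A s ω) (s := Finset.range t)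
    (t := Finset.univ) fun _ _ => Finset.mem_coe.2 (Finset.mem_univ _)
  rw [Finset.card_range] at this
  exact this.symm

/-- Sums over the recorded pulls of arm `a` along a run depend only on the first draws of that arm,
as many as there were pulls. -/
theorem sum_historyOf {R : Type*} [AddCommMonoid R] (p : Obs k → Prop) [DecidablePred p]
    (f : Obs k → R) (t : ℕ) (a : Fin n) :
    ∑ s ∈ (Finset.range t).filter
        (fun s => (historyOf X A ω s).1 = a ∧ p (historyOf X A ω s).2), f (historyOf X A ω s).2 =
      ∑ i ∈ (Finset.range (pulls A a t ω)).filter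
        (fun i => (soloHistory a (fun i => X a i ω) i).1 = a ∧
          p (soloHistory a (fun i => X a i ω) i).2), f (soloHistory a (fun i => X a i ω) i).2 := by
  have h := sum_filter_pulls A ω a
    (fun i => if p (observe (X a i ω)) then f (observe (X a i ω)) else 0) t
  simp only [soloHistory, true_and]
  refine Eq.trans ?_ (h.trans (Finset.sum_filter _ _).symm)
  rw [← Finset.filter_filter, Finset.sum_filter]
  refine Finset.sum_congr rfl fun s hs => ?_
  have hs' : A s ω = a := (Finset.mem_filter.1 hs).2
  simp [historyOf, hs']

variable (t : ℕ) (a : Fin n)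

theorem pullsSeen_historyOf : pullsSeen (historyOf X A ω) t a =
    pullsSeen (soloHistory a fun i => X a i ω) (pulls A a t ω) a := by
  simp only [pullsSeen, Finset.card_eq_sum_ones]
  exact sum_historyOf X A ω (fun y => y.2.isSome = true) (fun _ => 1) t a

theorem medCount_historyOf (m : Fin k) : medCount (historyOf X A ω) t a m =
    medCount (soloHistory a fun i => X a i ω) (pulls A a t ω) a m := by
  simp only [medCount, Finset.card_eq_sum_ones]
  exact sum_historyOf X A ω (fun y => y.2 = some m) (fun _ => 1) t a

theorem rewardCount_historyOf (m : Fin k) : rewardCount (historyOf X A ω) t a m =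
    rewardCount (soloHistory a fun i => X a i ω) (pulls A a t ω) a m := by
  simp only [rewardCount, rewardRounds, Finset.card_eq_sum_ones]
  exact sum_historyOf X A ω (fun y => y.2 = some m ∧ y.1.isSome = true) (fun _ => 1) t a

theorem medMeanHat_historyOf (m : Fin k) : medMeanHat (historyOf X A ω) t a m =
    medMeanHat (soloHistory a fun i => X a i ω) (pulls A a t ω) a m := by
  rw [medMeanHat, medMeanHat, rewardCount_historyOf]
  congr 1
  exact sum_historyOf X A ω (fun y => y.2 = some m ∧ y.1.isSome = true) (fun y => y.1.getD 0) t a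

theorem ucbIndex_historyOf (α : ℝ) (T : ℕ) : ucbIndex (historyOf X A ω) t a α T =
    ucbIndex (soloHistory a fun i => X a i ω) (pulls A a t ω) a α T := by
  simp only [ucbIndex, armMeanHat, medProbHat, pullsSeen_historyOf, medCount_historyOf,
    rewardCount_historyOf, medMeanHat_historyOf]

end Run

theorem ucbIndex_of_pos {n k : ℕ} {h : History n k} {t : ℕ} {a : Fin n} {α : ℝ} {T : ℕ}
    (h1 : 0 < pullsSeen h t a) (h2 : ∀ m, 0 < rewardCount h t a m) :
    ucbIndex h t a α T = ((armMeanHat h t a +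
      8 * √(α * Real.log T / 2 * varianceProxy h t a) : ℝ) : EReal) :=
  if_pos ⟨h1, fun m _ => h2 m⟩

/-! ### Regret on the event that all samples are typical -/

theorem sum_one_div_sqrt_le (N : ℕ) : ∑ i ∈ Finset.range N, 1 / √(i : ℝ) ≤ 2 * √(N : ℝ) := by
  have key : ∀ N : ℕ, ∑ i ∈ Finset.range (N + 1), 1 / √(i : ℝ) ≤ 2 * √(N : ℝ) := by
    intro N
    induction N with
    | zero => simp
    | succ N ih =>
      rw [Finset.sum_range_succ]
      have hpos : 0 < √((N + 1 : ℕ) : ℝ) := Real.sqrt_pos.2 (by positivity)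
      have h1 : √((N + 1 : ℕ) : ℝ) ^ 2 = N + 1 := by
        rw [Real.sq_sqrt (by positivity)]
        push_cast
        rfl
      have h2 : √(N : ℝ) ^ 2 = N := Real.sq_sqrt (by positivity)
      have h3 : 1 / √((N + 1 : ℕ) : ℝ) ≤ 2 * √((N + 1 : ℕ) : ℝ) - 2 * √(N : ℝ) := by
        rw [div_le_iff₀ hpos]
        nlinarith [sq_nonneg (√((N + 1 : ℕ) : ℝ) - √(N : ℝ))]
      linarith
  cases N with
  | zero => simp
  | succ N =>
    refine (key N).trans ?_
    gcongr
    simp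

section Regret

variable {n k : ℕ} {ν : Fin n → Measure (Draw k)} {Ω : Type*}
  {X : Fin n → ℕ → Ω → Draw k} {A : ℕ → Ω → Fin n} {α q : ℝ} {T : ℕ}

theorem bddAbove_armMean : BddAbove (Set.range (armMean ν)) := Set.finite_range _ |>.bddAbove

theorem IsMARInstance.gap_mem (hν : IsMARInstance ν) (a : Fin n) :
    (⨆ b, armMean ν b) - armMean ν a ∈ Set.Icc (0 : ℝ) 1 := by
  have : Nonempty (Fin n) := ⟨a⟩
  have h1 := le_ciSup bddAbove_armMean a (f := armMean ν)
  have h2 : ⨆ b, armMean ν b ≤ 1 := ciSup_le fun b => (hν.armMean_mem b).2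
  have h3 := (hν.armMean_mem a).1
  constructor <;> linarith

theorem IsRun.exploreRounds_le_pulls [MeasurableSpace Ω] (hA : IsRun α T X A) (ω : Ω) {t : ℕ}
    (htT : t < T) (ht : n * exploreRounds T ≤ t) (hK : 0 < exploreRounds T) (b : Fin n) :
    exploreRounds T ≤ pulls A b t ω := by
  set K := exploreRounds T
  rw [pulls]
  conv_lhs => rw [← Finset.card_range K]
  refine Finset.card_le_card_of_injOn (fun j => (b : ℕ) * K + j) ?_ fun i _ j _ hij => by
    simpa using hij
  intro j hj
  have hj' : j < K := by simpa using hj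
  have h1 : (b : ℕ) * K + j < n * K := by
    calc (b : ℕ) * K + j < (b : ℕ) * K + K := by omega
      _ = ((b : ℕ) + 1) * K := by ring
      _ ≤ n * K := Nat.mul_le_mul_right _ b.2
  simp only [Finset.coe_filter, Finset.mem_range, Set.mem_ofPred_eq]
  refine ⟨h1.trans_le ht, Fin.ext ?_⟩
  rw [hA.explore ω _ (h1.trans_le (ht.trans htT.le)) h1, mul_comm, Nat.mul_add_div hK,
    Nat.div_eq_of_lt hj', add_zero]

/-- Optimism: if the indices of the pulled arm and of an optimal arm are accurate, then the gap of
the pulled arm is at most twice its exploration bonus. -/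
theorem IsRun.gap_le [NeZero k] [MeasurableSpace Ω] (hA : IsRun α T X A) (hν : IsMARInstance ν)
    (hα : 1 < α) (hq0 : 0 < q)
    (hq : ∀ a m, q ≤ medProb ν a m * (outSeenProbOfMedSeen ν a m * medSeenProb ν a)) (ω : Ω)
    (hK : 0 < exploreRounds T)
    (htyp : ∀ a N, exploreRounds T ≤ N → N < T →
      IsTypical ν q (√(6 * Real.log T)) a N fun i => X a i ω)
    {t : ℕ} (htT : t < T) (ht : n * exploreRounds T ≤ t) :
    (⨆ b, armMean ν b) - armMean ν (A t ω) ≤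
      64 * √(α * Real.log T) * (√(armComplexity ν (outSeenProbOfMedSeen ν) (A t ω)) *
        (1 / √(pulls A (A t ω) t ω : ℝ))) := by
  have hL : 0 ≤ Real.log T := Real.log_natCast_nonneg T
  have hpull := hA.exploreRounds_le_pulls ω htT ht hK
  have hty : ∀ a, IsTypical ν q (√(6 * Real.log T)) a (pulls A a t ω) fun i => X a i ω := fun a =>
    htyp a _ (hpull a) ((pulls_le A ω a t).trans_lt htT)
  have hN : ∀ a, 0 < pulls A a t ω := fun a => hK.trans_le (hpull a)
  set V : Fin n → ℝ := fun a =>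
    varianceProxy (soloHistory a fun i => X a i ω) (pulls A a t ω) a with hV
  set H : Fin n → ℝ := fun a =>
    armMeanHat (soloHistory a fun i => X a i ω) (pulls A a t ω) a with hH
  have hV0 : ∀ a, 0 ≤ V a := fun a => varianceProxy_nonneg _ _ _
  have hidx : ∀ a, ucbIndex (historyOf X A ω) t a α T =
      ((H a + 8 * √(α * Real.log T / 2 * V a) : ℝ) : EReal) := fun a => by
    rw [ucbIndex_historyOf]
    exact ucbIndex_of_pos ((hty a).pullsSeen_pos hν (hN a) (hq a))
      ((hty a).rewardCount_pos hq0 (hN a) (hq a))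
  have hdev : ∀ a, |H a - armMean ν a| ≤ 8 * √(α * Real.log T / 2 * V a) := fun a => by
    refine ((hty a).abs_armMeanHat_sub_le hν hq0 (Real.sqrt_nonneg _) (hN a) (hq a)).trans ?_
    -- `2 √(6 L V) = √(24 L V) ≤ √(32 α L V)`
    rw [mul_assoc, ← Real.sqrt_mul (by positivity)]
    refine le_of_sq_le_sq ?_ (by positivity)
    rw [mul_pow, mul_pow, Real.sq_sqrt (mul_nonneg (by positivity) (hV0 a)),
      Real.sq_sqrt (mul_nonneg (by positivity) (hV0 a))]
    change 2 ^ 2 * (6 * Real.log T * V a) ≤ _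
    nlinarith [mul_nonneg hL (hV0 a), mul_nonneg (mul_nonneg hL (hV0 a)) (sub_nonneg.2 hα.le)]
  have : Nonempty (Fin n) := ⟨A t ω⟩
  obtain ⟨b, hb⟩ := Set.Nonempty.csSup_mem (Set.range_nonempty (armMean ν)) (Set.finite_range _)
  have hb' : armMean ν b = ⨆ c, armMean ν c := hb
  have hle := hA.exploit ω t htT ht b
  rw [hidx, hidx, EReal.coe_le_coe_iff] at hle
  have h1 := (abs_le.1 (hdev b)).1
  have h2 := (abs_le.1 (hdev (A t ω))).2
  have h3 : (⨆ b, armMean ν b) - armMean ν (A t ω) ≤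
      16 * √(α * Real.log T / 2 * V (A t ω)) := by
    rw [← hb']
    linarith
  refine h3.trans ?_
  have hVle := (hty (A t ω)).varianceProxy_le hν (hN _) (hq _)
  set Pa := armComplexity ν (outSeenProbOfMedSeen ν) (A t ω) with hPa
  have hPa0 : 0 ≤ Pa := zero_le_one.trans (one_le_armComplexity hν _)
  have hNr : (0 : ℝ) < pulls A (A t ω) t ω := by exact_mod_cast hN _
  have hαL : 0 ≤ α * Real.log T := by positivity
  calc 16 * √(α * Real.log T / 2 * V (A t ω))
      ≤ 16 * √(α * Real.log T / 2 * (32 * Pa / pulls A (A t ω) t ω)) := by gcongr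
    _ = 16 * √(4 ^ 2 * ((α * Real.log T) * (Pa / pulls A (A t ω) t ω))) := by
        congr 2
        ring
    _ = _ := by
        rw [Real.sqrt_mul (by positivity), Real.sqrt_sq (by norm_num), Real.sqrt_mul hαL,
          Real.sqrt_div hPa0]
        ring

/-- The gap bound is summed over the pulls of each arm with `∑ 1 / √i ≤ 2 √N`, and over the arms
with the Cauchy–Schwarz inequality; each exploration round costs at most `1`. -/
theorem IsRun.regret_le [NeZero k] [MeasurableSpace Ω] (hA : IsRun α T X A)
    (hν : IsMARInstance ν) (hα : 1 < α) (hq0 : 0 < q)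
    (hq : ∀ a m, q ≤ medProb ν a m * (outSeenProbOfMedSeen ν a m * medSeenProb ν a)) (ω : Ω)
    (hK : 0 < exploreRounds T)
    (htyp : ∀ a N, exploreRounds T ≤ N → N < T →
      IsTypical ν q (√(6 * Real.log T)) a N fun i => X a i ω) :
    regret ν A T ω ≤ n * exploreRounds T + 128 * √(α * T * Real.log T *
      ∑ a, armComplexity ν (outSeenProbOfMedSeen ν) a) := by
  have hL : 0 ≤ Real.log T := Real.log_natCast_nonneg T
  set Q := armComplexity ν (outSeenProbOfMedSeen ν)
  have hQ : ∀ a, 0 ≤ Q a := fun a => zero_le_one.trans (one_le_armComplexity hν a)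
  set c := 64 * √(α * Real.log T) with hc
  let F : Fin n → ℕ → ℝ := fun a i => √(Q a) * (1 / √(i : ℝ))
  have hF : ∀ a i, 0 ≤ F a i := fun a i => by positivity
  have hround : ∀ t ∈ Finset.range T, (⨆ b, armMean ν b) - armMean ν (A t ω) ≤
      (if t < n * exploreRounds T then 1 else 0) + c * F (A t ω) (pulls A (A t ω) t ω) := by
    intro t ht
    split_ifs with h
    · have := (hν.gap_mem (A t ω)).2
      have := mul_nonneg (show 0 ≤ c by positivity) (hF (A t ω) (pulls A (A t ω) t ω))
      linarith
    · rw [zero_add]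
      exact hA.gap_le hν hα hq0 hq ω hK htyp (Finset.mem_range.1 ht) (not_lt.1 h)
  have hexp : ∑ t ∈ Finset.range T, (if t < n * exploreRounds T then (1 : ℝ) else 0) ≤
      n * exploreRounds T := by
    rw [← Finset.sum_filter, Finset.sum_const, nsmul_eq_mul, mul_one]
    have : ((Finset.range T).filter fun t => t < n * exploreRounds T).card ≤
        n * exploreRounds T := by
      calc _ ≤ (Finset.range (n * exploreRounds T)).card :=
            Finset.card_le_card fun t ht => by
              rw [Finset.mem_filter] at ht
              exact Finset.mem_range.2 ht.2
        _ = _ := Finset.card_range _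
    exact_mod_cast this
  have hsum : ∑ t ∈ Finset.range T, F (A t ω) (pulls A (A t ω) t ω) ≤
      2 * (√(∑ a, Q a) * √(T : ℝ)) := by
    calc ∑ t ∈ Finset.range T, F (A t ω) (pulls A (A t ω) t ω)
        = ∑ a, ∑ t ∈ (Finset.range T).filter (fun t => A t ω = a), F a (pulls A a t ω) := by
          rw [← Finset.sum_fiberwise _ (fun t => A t ω)]
          refine Finset.sum_congr rfl fun a _ => Finset.sum_congr rfl fun t ht => ?_
          rw [(Finset.mem_filter.1 ht).2]
      _ = ∑ a, √(Q a) * ∑ i ∈ Finset.range (pulls A a T ω), 1 / √(i : ℝ) := by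
          refine Finset.sum_congr rfl fun a _ => ?_
          rw [sum_filter_pulls A ω a (F a) T, Finset.mul_sum]
      _ ≤ ∑ a, √(Q a) * (2 * √(pulls A a T ω : ℝ)) := by
          gcongr with a
          exact sum_one_div_sqrt_le _
      _ = 2 * ∑ a, √(Q a) * √(pulls A a T ω : ℝ) := by
          rw [Finset.mul_sum]
          exact Finset.sum_congr rfl fun a _ => by ring
      _ ≤ 2 * (√(∑ a, Q a) * √(∑ a, (pulls A a T ω : ℝ))) := by
          gcongr
          exact Real.sum_sqrt_mul_sqrt_le _ hQ fun a => Nat.cast_nonneg _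
      _ = _ := by
          rw [← Nat.cast_sum, sum_pulls]
  have hαL : 0 ≤ α * Real.log T := by positivity
  have hfin : √(α * T * Real.log T * ∑ a, Q a) =
      √(α * Real.log T) * (√(∑ a, Q a) * √(T : ℝ)) := by
    rw [← Real.sqrt_mul (Finset.sum_nonneg fun a _ => hQ a), ← Real.sqrt_mul hαL]
    congr 1
    ring
  calc regret ν A T ω
      ≤ ∑ t ∈ Finset.range T, ((if t < n * exploreRounds T then (1 : ℝ) else 0) +
          c * F (A t ω) (pulls A (A t ω) t ω)) := Finset.sum_le_sum hround
    _ ≤ n * exploreRounds T + c * (2 * (√(∑ a, Q a) * √(T : ℝ))) := by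
        rw [Finset.sum_add_distrib, ← Finset.mul_sum]
        gcongr
    _ = _ := by
        rw [hfin, hc]
        ring

end Regret

/-! ### Expected regret -/

section Expectation

variable {n k : ℕ} {ν : Fin n → Measure (Draw k)} {Ω : Type*} [MeasurableSpace Ω]
  {P : Measure Ω} {X : Fin n → ℕ → Ω → Draw k} {A : ℕ → Ω → Fin n} {α q : ℝ} {T : ℕ}

/-- The union bound over the arms and the numbers of pulls. The additive accuracy of the counts is
available because every arm has at least `log² T` pulls, which makes `exp (-N q² / 8)` smaller than
any power of `1 / T`. -/
theorem measure_exists_not_isTypical_le (hν : IsMARInstance ν) (hX : IsDrawTable ν P X)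
    (hq0 : 0 < q) (hL : 0 < Real.log T) (hTq : 24 / q ^ 2 ≤ Real.log T) :
    P {ω | ∃ a, ∃ N ∈ Finset.Ico (exploreRounds T) T,
      ¬ IsTypical ν q (√(6 * Real.log T)) a N fun i => X a i ω} ≤
        ENNReal.ofReal (n * (4 * k + 6) / T ^ 2) := by
  set η := ENNReal.ofReal (Real.exp (-(3 * Real.log T))) with hη
  have hone : ∀ a, ∀ N ∈ Finset.Ico (exploreRounds T) T,
      P {ω | ¬ IsTypical ν q (√(6 * Real.log T)) a N fun i => X a i ω} ≤ (4 * k + 6) * η := by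
    intro a N hN
    have hN1 : Real.log T ^ 2 ≤ N :=
      (Nat.le_ceil _).trans (by exact_mod_cast (Finset.mem_Ico.1 hN).1)
    have h := measure_not_isTypical_le hν hX a N hq0.le (Real.sqrt_nonneg (6 * Real.log T))
    have e1 : √(6 * Real.log T) ^ 2 / 2 = 3 * Real.log T := by
      rw [Real.sq_sqrt (by positivity)]
      ring
    have e2 : 3 * Real.log T ≤ N * q ^ 2 / 8 := by
      rw [div_le_iff₀ (by positivity)] at hTq
      nlinarith [mul_le_mul_of_nonneg_left hTq hL.le, mul_le_mul_of_nonneg_right hN1 (sq_nonneg q)]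
    rw [e1] at h
    calc _ ≤ _ := h
      _ ≤ (2 * k + 1) * (2 * η) + 2 * (2 * η) := by
          gcongr
          exact ENNReal.ofReal_le_ofReal (Real.exp_le_exp.2 (neg_le_neg e2))
      _ = _ := by ring
  have hset : {ω | ∃ a, ∃ N ∈ Finset.Ico (exploreRounds T) T,
      ¬ IsTypical ν q (√(6 * Real.log T)) a N fun i => X a i ω} =
      ⋃ a, ⋃ N ∈ Finset.Ico (exploreRounds T) T,
        {ω | ¬ IsTypical ν q (√(6 * Real.log T)) a N fun i => X a i ω} := by
    ext ω
    simp only [Set.mem_iUnion, Set.mem_ofPred_eq, exists_prop]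
  have hT : (0 : ℝ) < T := by
    rcases Nat.eq_zero_or_pos T with rfl | h
    · simp at hL
    · exact_mod_cast h
  rw [hset]
  calc _ ≤ ∑ _a : Fin n, ∑ _N ∈ Finset.Ico (exploreRounds T) T, (4 * k + 6) * η :=
        (measure_iUnion_fintype_le P _).trans <| Finset.sum_le_sum fun a _ =>
          (measure_biUnion_finset_le _ _).trans <| Finset.sum_le_sum fun N hN => hone a N hN
    _ ≤ n * (T * ((4 * k + 6) * η)) := by
        rw [Finset.sum_const, Finset.sum_const, Finset.card_univ, Fintype.card_fin, nsmul_eq_mul,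
          nsmul_eq_mul, Nat.card_Ico]
        gcongr
        exact Nat.sub_le _ _
    _ = ENNReal.ofReal (n * (T * ((4 * k + 6) * Real.exp (-(3 * Real.log T))))) := by
        rw [ENNReal.ofReal_mul (by positivity), ENNReal.ofReal_mul (by positivity),
          ENNReal.ofReal_mul (by positivity), ENNReal.ofReal_add (by positivity) (by positivity),
          ENNReal.ofReal_mul (by positivity)]
        simp [hη]
    _ = _ := by
        congr 1
        have : Real.exp (-(3 * Real.log T)) = 1 / (T : ℝ) ^ 3 := by
          rw [Real.exp_neg, mul_comm, Real.exp_mul, Real.exp_log hT, one_div]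
          norm_cast
        rw [this]
        field_simp

/-- For a large horizon the exploration phase and the failure event are absorbed into the main
term. -/
theorem integral_regret_le [NeZero k] [NeZero n] [IsProbabilityMeasure P] (hν : IsMARInstance ν)
    (hX : IsDrawTable ν P X) (hA : IsRun α T X A) (hα : 1 < α) (hq0 : 0 < q)
    (hq : ∀ a m, q ≤ medProb ν a m * (outSeenProbOfMedSeen ν a m * medSeenProb ν a))
    (hL : 1 ≤ Real.log T) (hTq : 24 / q ^ 2 ≤ Real.log T) (hTn : (n * (4 * k + 6) : ℝ) ≤ T)
    (hTK : (n * (Real.log T ^ 2 + 1) + 1 : ℝ) ≤ √T) :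
    ∫ ω, regret ν A T ω ∂P ≤ 129 * √(α * T * Real.log T *
      ∑ a, armComplexity ν (outSeenProbOfMedSeen ν) a) := by
  have hL0 : 0 < Real.log T := zero_lt_one.trans_le hL
  have hT : (0 : ℝ) < T := by
    rcases Nat.eq_zero_or_pos T with rfl | h
    · simp at hL0
    · exact_mod_cast h
  have hK : 0 < exploreRounds T := Nat.ceil_pos.2 (by positivity)
  set U := {ω | ∃ a, ∃ N ∈ Finset.Ico (exploreRounds T) T,
      ¬ IsTypical ν q (√(6 * Real.log T)) a N fun i => X a i ω} with hU
  have hPU := measure_exists_not_isTypical_le hν hX hq0 hL0 hTq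
  rw [← hU, ← measure_toMeasurable] at hPU
  set U' := toMeasurable P U with hU'
  have hU'm : MeasurableSet U' := measurableSet_toMeasurable _ _
  have hPU' : P.real U' ≤ n * (4 * k + 6) / T ^ 2 :=
    ENNReal.toReal_le_of_le_ofReal (by positivity) hPU
  set G := √(α * T * Real.log T * ∑ a, armComplexity ν (outSeenProbOfMedSeen ν) a) with hG
  have hpt : ∀ ω, regret ν A T ω ≤
      (n * exploreRounds T + 128 * G) + U'.indicator (fun _ => (T : ℝ)) ω := by
    intro ω
    by_cases h : ω ∈ U'
    · rw [Set.indicator_of_mem h]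
      have : regret ν A T ω ≤ ∑ _t ∈ Finset.range T, (1 : ℝ) :=
        Finset.sum_le_sum fun t _ => (hν.gap_mem (A t ω)).2
      rw [Finset.sum_const, Finset.card_range, nsmul_eq_mul, mul_one] at this
      have h0 : (0 : ℝ) ≤ n * exploreRounds T + 128 * G := by positivity
      linarith
    · rw [Set.indicator_of_notMem h, add_zero]
      have hnU : ω ∉ U := fun h' => h (subset_toMeasurable P U h')
      refine hA.regret_le hν hα hq0 hq ω hK fun a N h1 h2 => ?_
      by_contra hcon
      exact hnU ⟨a, N, Finset.mem_Ico.2 ⟨h1, h2⟩, hcon⟩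
  have hint : Integrable (U'.indicator fun _ => (T : ℝ)) P :=
    (integrable_const _).indicator hU'm
  have hI : ∫ ω, regret ν A T ω ∂P ≤ (n * exploreRounds T + 128 * G) + P.real U' * T := by
    calc ∫ ω, regret ν A T ω ∂P
        ≤ ∫ ω, ((n * exploreRounds T + 128 * G) + U'.indicator (fun _ => (T : ℝ)) ω) ∂P :=
          integral_mono_of_nonneg
            (ae_of_all _ fun ω => Finset.sum_nonneg fun t _ => (hν.gap_mem (A t ω)).1)
            ((integrable_const _).add hint) (ae_of_all _ hpt)
      _ = _ := by
          rw [integral_add (integrable_const _) hint, integral_const, probReal_univ, one_smul,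
            integral_indicator_const _ hU'm, smul_eq_mul]
  have hfail : P.real U' * T ≤ 1 := by
    calc P.real U' * T ≤ n * (4 * k + 6) / T ^ 2 * T := by gcongr
      _ = n * (4 * k + 6) / T := by field_simp
      _ ≤ 1 := (div_le_one hT).2 hTn
  have hKle : (n * exploreRounds T : ℝ) ≤ n * (Real.log T ^ 2 + 1) := by
    gcongr
    exact (Nat.ceil_lt_add_one (by positivity)).le
  -- The exploration phase and the failure event cost at most `√T`, and each complexity
  -- is at least 1.
  have hTG : √T ≤ G := by
    refine Real.sqrt_le_sqrt ?_
    have hsum : (1 : ℝ) ≤ ∑ a, armComplexity ν (outSeenProbOfMedSeen ν) a := by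
      have h0 := one_le_armComplexity hν (0 : Fin n)
      refine h0.trans (Finset.single_le_sum (f := armComplexity ν (outSeenProbOfMedSeen ν))
        (fun a _ => zero_le_one.trans (one_le_armComplexity hν a)) (Finset.mem_univ 0))
    calc (T : ℝ) ≤ T * (α * Real.log T * ∑ a, armComplexity ν (outSeenProbOfMedSeen ν) a) :=
          le_mul_of_one_le_right hT.le
            (one_le_mul_of_one_le_of_one_le (one_le_mul_of_one_le_of_one_le hα.le hL) hsum)
      _ = _ := by ring
  linarith

end Expectation

/-- The conditions on the horizon hold eventually, since `log² T = o(√T)`. -/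
theorem eventually_horizon (n k : ℕ) (q : ℝ) : ∀ᶠ T : ℕ in Filter.atTop,
    1 ≤ Real.log T ∧ 24 / q ^ 2 ≤ Real.log T ∧ (n * (4 * k + 6) : ℝ) ≤ T ∧
      (n * (Real.log T ^ 2 + 1) + 1 : ℝ) ≤ √T := by
  have hcast := tendsto_natCast_atTop_atTop (R := ℝ)
  have hlog := Real.tendsto_log_atTop.comp hcast
  have hsqrt := Real.tendsto_sqrt_atTop.comp hcast
  have ho := (isLittleO_log_rpow_rpow_atTop 2 (show (0 : ℝ) < 1 / 2 by norm_num)).comp_tendsto hcast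
  have ho' := ho.bound (show (0 : ℝ) < 1 / (2 * (n + 1)) by positivity)
  filter_upwards [hlog.eventually_ge_atTop 1, hlog.eventually_ge_atTop (24 / q ^ 2),
    hcast.eventually_ge_atTop (n * (4 * k + 6) : ℝ), ho',
    hsqrt.eventually_ge_atTop (2 * (n + 1) : ℝ)] with T h1 h2 h3 h4 h5
  refine ⟨h1, h2, h3, ?_⟩
  simp only [Function.comp_apply, ← Real.sqrt_eq_rpow, Real.rpow_ofNat, Real.norm_eq_abs,
    abs_of_nonneg (sq_nonneg (Real.log T)), abs_of_nonneg (Real.sqrt_nonneg _)] at h4 h5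
  rw [div_mul_eq_mul_div, one_mul, le_div_iff₀ (by positivity)] at h4
  nlinarith [sq_nonneg (Real.log T)]

end MissingBandit

theorem mainTheorem8 :
    ∃ C : ℝ, 0 < C ∧
      ∀ (n k : ℕ) (α q : ℝ), 1 < α → 0 < q →
      ∃ T₀ : ℕ, ∀ T : ℕ, T₀ ≤ T →
      ∀ ν : Fin n → Measure (Draw k), IsMARInstance ν →
      (∀ a m, q ≤ medProb ν a m * (outSeenProbOfMedSeen ν a m * medSeenProb ν a)) →
      ∀ (Ω : Type*) [MeasurableSpace Ω] (P : Measure Ω) [IsProbabilityMeasure P]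
        (X : Fin n → ℕ → Ω → Draw k) (A : ℕ → Ω → Fin n),
      IsDrawTable ν P X → IsRun α T X A →
      (∫ ω, regret ν A T ω ∂P ≤
        C * Real.sqrt (α * T * Real.log T * n * meanComplexity ν (outSeenProbOfMedSeen ν))) ∧
      ((∀ a m, IndepFun mediatorSeen outcomeSeen (lawGivenMed ν a m)) →
        ∫ ω, regret ν A T ω ∂P ≤
          C * Real.sqrt (α * T * Real.log T * n * meanComplexity ν (outSeenProb ν))) := by
  refine ⟨129, by norm_num, fun n k α q hα hq0 => ?_⟩
  obtain ⟨T₀, hT₀⟩ := Filter.eventually_atTop.1 (eventually_horizon n k q)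
  refine ⟨T₀, fun T hT ν hν hq Ω _ P _ X A hX hA => ?_⟩
  obtain ⟨h1, h2, h3, h4⟩ := hT₀ T hT
  obtain ⟨ω⟩ : Nonempty Ω := nonempty_of_isProbabilityMeasure P
  have : NeZero n := ⟨fun h => (h ▸ A 0 ω : Fin 0).elim0⟩
  have : NeZero k := ⟨fun h => (h ▸ mediator (X 0 0 ω) : Fin 0).elim0⟩
  have hn : (n : ℝ) ≠ 0 := NeZero.ne _
  have hmain : ∫ ω, regret ν A T ω ∂P ≤ 129 * √(α * T * Real.log T * n *
      meanComplexity ν (outSeenProbOfMedSeen ν)) := by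
    convert integral_regret_le hν hX hA hα hq0 hq h1 h2 h3 h4 using 3
    rw [meanComplexity]
    field_simp
  refine ⟨hmain, fun hind => ?_⟩
  rw [← hν.outSeenProbOfMedSeen_eq hind]
  exact hmain
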